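/- Let $\mathbb{F}_v$ be a finite field with $q_v$ elements and characteristic $p$, let $z$ be a variable, and put $A_v=\mathbb{F}_v[[z]]$. Let $R$ be the valuation ring of a complete discretely valued field $K=\mathrm{Frac}(R)$ (that is, a complete discrete valuation ring), with maximal ideal $\mathfrak m_R$, equipped with a ring homomorphism $\gamma\colon A_v\to R$ such that $\zeta:=\gamma(z)$ is a non-zero element of $\mathfrak m_R$; so $R$ is an $\mathbb{F}_v$-algebra. Assume that the residue field $R/\mathfrak m_R$ is algebraic over $\mathbb{F}_v$ (for instance finite). Let $K^{sep}$ be a separable closure of $K$. On $R[[z]]$ and $K^{sep}[[z]]$ let $\hat\sigma$ be the endomorphism with $\hat\sigma(z)=z$ that raises coefficients to the power $q_v$. A local shtuka $\underline{\hat M}=(\hat M,\tau)$ of rank $r$ over $R$ is a free $R[[z]]$-module $\hat M$ of rank $r$ together with an isomorphism $\tau\colon \hat\sigma^*\hat M[\tfrac1{z-\zeta}]\to\hat M[\tfrac1{z-\zeta}]$ of $R[[z]][\tfrac1{z-\zeta}]$-modules. Its dimension is the integer $d$ with $\det\tau\in(z-\zeta)^d\,R[[z]]^\times$, the determinant being computed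 in any $R[[z]]$-basis of $\hat M$. Its (dual) Tate module is the $\mathbb{F}_v[[z]]$-module $$\check T\underline{\hat M}=\{m\in\hat M\otimes_{R[[z]]}K^{sep}[[z]] \;:\; \tau(\hat\sigma^*m)=m\},$$ on which $\mathrm{Gal}(K^{sep}/K)$ acts through the coefficients of $K^{sep}[[z]]$. **Proposition.** Let $\underline{\hat M}$ be a local shtuka of rank $r\ge 1$ and dimension $d\in\mathbb{Z}$ over $R$, and suppose that $p\mid d$. Then $\check T\underline{\hat M}$ is a free $\mathbb{F}_v[[z]]$-module of rank $r$, and for every $\mathbb{F}_v[[z]]$-basis of it the image of the resulting Galois representation $\rho\colon\mathrm{Gal}(K^{sep}/K)\to\mathrm{GL}_r(\mathbb{F}_v[[z]])$ is not open for the $z$-adic topology. -/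

import Mathlib

open scoped PowerSeries TensorProduct Topology

noncomputable section

/-! ### Base change of a module along a ring homomorphism -/

section BaseChange

variable {A B C M N : Type*} [CommRing A] [CommRing B] [CommRing C]
  [AddCommGroup M] [Module A M] [AddCommGroup N] [Module C N]

/-- The `B`-module `M ⊗_{A,f} B` for a ring homomorphism `f : A → B` and an `A`-module `M`. -/
def BaseChange {A B : Type*} [CommRing A] [CommRing B] (f : A →+* B)
    (M : Type*) [AddCommGroup M] [Module A M] : Type _ :=
  letI := f.toAlgebra
  B ⊗[A] M

namespace BaseChange

instance (f : A →+* B) : AddCommGroup (BaseChange f M) :=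
  letI := f.toAlgebra
  (TensorProduct.addCommGroup : AddCommGroup (B ⊗[A] M))

instance (f : A →+* B) : Module B (BaseChange f M) :=
  letI := f.toAlgebra
  (TensorProduct.leftModule : Module B (B ⊗[A] M))

/-- The canonical `f`-semilinear map `M → M ⊗_{A,f} B`, `m ↦ m ⊗ 1`. -/
def of (f : A →+* B) (M : Type*) [AddCommGroup M] [Module A M] : M →ₛₗ[f] BaseChange f M where
  toFun m := letI := f.toAlgebra; (1 : B) ⊗ₜ[A] m
  map_add' x y := letI := f.toAlgebra; TensorProduct.tmul_add (1 : B) x y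
  map_smul' a m := by
    let := f.toAlgebra
    change (1 : B) ⊗ₜ[A] (a • m) = f a • ((1 : B) ⊗ₜ[A] m)
    rw [TensorProduct.tmul_smul, TensorProduct.smul_tmul', TensorProduct.smul_tmul',
      Algebra.smul_def, smul_eq_mul]
    rfl

theorem induction_on {f : A →+* B} {P : BaseChange f M → Prop} (x : BaseChange f M)
    (zero : P 0) (smul_of : ∀ (b : B) (m : M), P (b • of f M m))
    (add : ∀ x y, P x → P y → P (x + y)) : P x := by
  let := f.toAlgebra
  refine TensorProduct.induction_on (motive := P) x zero (fun b m => ?_) add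
  have h := smul_of b m
  have e : b • of f M m = (b ⊗ₜ[A] m : B ⊗[A] M) := by
    change b • ((1 : B) ⊗ₜ[A] m) = _
    rw [TensorProduct.smul_tmul', smul_eq_mul, mul_one]
  rwa [e] at h

/-- The additive map underlying `BaseChange.lift`. -/
def liftAdd {f : A →+* B} (g : B →+* C) (h : M →ₛₗ[g.comp f] N) : BaseChange f M →+ N :=
  letI := f.toAlgebra
  (TensorProduct.liftAddHom
    (AddMonoidHom.mk' (fun b : B => AddMonoidHom.mk' (fun m : M => g b • h m)
        (fun x y => by rw [map_add, smul_add]))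
      (fun b c => AddMonoidHom.ext fun m => by
        change g (b + c) • h m = g b • h m + g c • h m
        rw [map_add, add_smul]))
    (fun a b m => by
      change g (f a * b) • h m = g b • h (a • m)
      rw [LinearMap.map_smulₛₗ, smul_smul, map_mul, mul_comm, RingHom.comp_apply]) :
    B ⊗[A] M →+ N)

theorem liftAdd_smul_of {f : A →+* B} (g : B →+* C) (h : M →ₛₗ[g.comp f] N) (b : B) (m : M) :
    liftAdd g h (b • of f M m) = g b • h m := by
  change g (b * 1) • h m = g b • h m
  rw [mul_one]

/-- The extension of a `(g ∘ f)`-semilinear map `h : M → N` to the `g`-semilinear map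
`M ⊗_{A,f} B → N`, `m ⊗ b ↦ g(b) • h(m)`. -/
def lift {f : A →+* B} (g : B →+* C) (h : M →ₛₗ[g.comp f] N) : BaseChange f M →ₛₗ[g] N where
  toFun := liftAdd g h
  map_add' := map_add _
  map_smul' b x := by
    refine induction_on (P := fun x => liftAdd g h (b • x) = g b • liftAdd g h x) x ?_ ?_ ?_
    · rw [smul_zero, map_zero, smul_zero]
    · intro c m
      rw [smul_smul, liftAdd_smul_of, liftAdd_smul_of, map_mul, mul_smul]
    · intro x y hx hy
      rw [smul_add, map_add, map_add, hx, hy, smul_add]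

@[simp] theorem lift_of {f : A →+* B} (g : B →+* C) (h : M →ₛₗ[g.comp f] N) (m : M) :
    lift g h (of f M m) = h m := by
  have := liftAdd_smul_of g h 1 m
  rw [one_smul, map_one, one_smul] at this
  exact this

end BaseChange

end BaseChange

/-! ### Local shtukas -/

section Shtuka

/-- The ring endomorphism `σ̂` of `B⟦z⟧`, for an `𝔽`-algebra `B` over a finite field with `q`
elements: `σ̂(z) = z` and `σ̂(b) = b ^ q` for `b ∈ B`. -/
def sigmaHat (𝔽 B : Type*) [Field 𝔽] [Fintype 𝔽] [CommRing B] [Algebra 𝔽 B] : B⟦X⟧ →+* B⟦X⟧ :=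
  PowerSeries.map (FiniteField.frobeniusAlgHom 𝔽 B : B →+* B)

/-- The localization `R⟦z⟧[1/(z - ζ)]`. -/
abbrev Loc {R : Type*} [CommRing R] (ζ : R) : Type _ :=
  Localization.Away (PowerSeries.X - PowerSeries.C ζ : R⟦X⟧)

/-- The localization map `R⟦z⟧ → R⟦z⟧[1/(z - ζ)]`. -/
abbrev toLoc {R : Type*} [CommRing R] (ζ : R) : R⟦X⟧ →+* Loc ζ :=
  algebraMap R⟦X⟧ (Loc ζ)

/-- `z - ζ` as a unit of `R⟦z⟧[1/(z - ζ)]`. -/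
def zSubZeta {R : Type*} [CommRing R] (ζ : R) : (Loc ζ)ˣ :=
  (IsLocalization.Away.algebraMap_isUnit (S := Loc ζ) (PowerSeries.X - PowerSeries.C ζ : R⟦X⟧)).unit

/-- A local `σ̂`-shtuka over `R`: a finite free `R⟦z⟧`-module `M` with an isomorphism
`τ : σ̂^*M[1/(z - ζ)] ≅ M[1/(z - ζ)]` of `R⟦z⟧[1/(z - ζ)]`-modules. -/
structure LocalShtuka (𝔽 : Type*) [Field 𝔽] [Fintype 𝔽] {R : Type*} [CommRing R] [Algebra 𝔽 R]
    (ζ : R) where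
  carrier : Type*
  [addCommGroup : AddCommGroup carrier]
  [module : Module R⟦X⟧ carrier]
  [free : Module.Free R⟦X⟧ carrier]
  [finite : Module.Finite R⟦X⟧ carrier]
  τ : BaseChange (toLoc ζ) (BaseChange (sigmaHat 𝔽 R) carrier) ≃ₗ[Loc ζ]
    BaseChange (toLoc ζ) carrier

namespace LocalShtuka

attribute [instance] addCommGroup module free finite

section Basic

variable {𝔽 : Type*} [Field 𝔽] [Fintype 𝔽] {R : Type*} [CommRing R] [Algebra 𝔽 R] {ζ : R}
  (M : LocalShtuka 𝔽 ζ)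

/-- The rank of a local shtuka. -/
def rank : ℕ := Module.finrank R⟦X⟧ M.carrier

/-- The semilinear map `M → M[1/(z - ζ)]`, `m ↦ τ(σ̂^*m)`. -/
def tauMap : M.carrier →ₛₗ[(toLoc ζ).comp (sigmaHat 𝔽 R)] BaseChange (toLoc ζ) M.carrier where
  toFun m := M.τ (BaseChange.of (toLoc ζ) _ (BaseChange.of (sigmaHat 𝔽 R) _ m))
  map_add' x y := by simp
  map_smul' a m := by simp

/-- `M` has dimension `d` if `det τ ∈ (z - ζ) ^ d • R⟦z⟧ˣ`, where the determinant is that of the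
matrix `T` of `τ` with respect to an `R⟦z⟧`-basis `b` of `M` and the induced bases `σ̂^*b` and `b`
of the two sides.  (Another basis changes `det τ` by a unit of `R⟦z⟧`.) -/
def HasDimension (d : ℤ) : Prop :=
  ∃ (b : Module.Basis (Fin M.rank) R⟦X⟧ M.carrier) (T : Matrix (Fin M.rank) (Fin M.rank) (Loc ζ)),
    (∀ j, M.tauMap (b j) = ∑ i, T i j • BaseChange.of (toLoc ζ) _ (b i)) ∧
    ∃ c : R⟦X⟧ˣ, T.det = ((zSubZeta ζ ^ d : (Loc ζ)ˣ) : Loc ζ) * toLoc ζ (c : R⟦X⟧)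

end Basic

/-! ### The Tate module and its Galois representation -/

section Tate

variable {𝔽 : Type*} [Field 𝔽] [Fintype 𝔽] {R : Type*} [CommRing R] [Algebra 𝔽 R] {ζ : R}

theorem algebraMap_sep_ne_zero {R : Type*} [CommRing R] [IsDomain R] {ζ : R}
    (K : Type*) [Field K] [Algebra R K] [IsFractionRing R K]
    (Ks : Type*) [Field Ks] [Algebra K Ks] [Algebra R Ks] [IsScalarTower R K Ks] (hζ : ζ ≠ 0) :
    algebraMap R Ks ζ ≠ 0 := by
  rw [IsScalarTower.algebraMap_apply R K Ks, Ne, map_eq_zero]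
  exact (map_ne_zero_iff _ (IsFractionRing.injective R K)).2 hζ

section Fibre

variable (Ks : Type*) [Field Ks] [Algebra R Ks] (M : LocalShtuka 𝔽 ζ)

/-- The inclusion `R⟦z⟧ → K^sep⟦z⟧`. -/
abbrev toSep (R Ks : Type*) [CommRing R] [Field Ks] [Algebra R Ks] : R⟦X⟧ →+* Ks⟦X⟧ :=
  PowerSeries.map (algebraMap R Ks)

theorem isUnit_toSep {R Ks : Type*} [CommRing R] [Field Ks] [Algebra R Ks] {ζ : R}
    (hζ : algebraMap R Ks ζ ≠ 0) : IsUnit (toSep R Ks (PowerSeries.X - PowerSeries.C ζ)) := by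
  rw [PowerSeries.isUnit_iff_constantCoeff]
  simpa using hζ

/-- The canonical homomorphism `R⟦z⟧[1/(z - ζ)] → K^sep⟦z⟧`, which exists because `ζ ≠ 0`. -/
def locToSep {R Ks : Type*} [CommRing R] [Field Ks] [Algebra R Ks] {ζ : R}
    (hζ : algebraMap R Ks ζ ≠ 0) : Loc ζ →+* Ks⟦X⟧ :=
  IsLocalization.Away.lift (S := Loc ζ) (PowerSeries.X - PowerSeries.C ζ : R⟦X⟧) (isUnit_toSep hζ)

theorem locToSep_toLoc {R Ks : Type*} [CommRing R] [Field Ks] [Algebra R Ks] {ζ : R}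
    (hζ : algebraMap R Ks ζ ≠ 0) (a : R⟦X⟧) : locToSep hζ (toLoc ζ a) = toSep R Ks a :=
  IsLocalization.Away.lift_eq (S := Loc ζ) (PowerSeries.X - PowerSeries.C ζ : R⟦X⟧) (isUnit_toSep hζ) a

/-- `M ⊗_{R⟦z⟧} K^sep⟦z⟧`. -/
def SepFibre : Type _ := BaseChange (toSep R Ks) M.carrier

instance : AddCommGroup (SepFibre Ks M) :=
  inferInstanceAs (AddCommGroup (BaseChange (toSep R Ks) M.carrier))

instance : Module Ks⟦X⟧ (SepFibre Ks M) :=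
  inferInstanceAs (Module Ks⟦X⟧ (BaseChange (toSep R Ks) M.carrier))

/-- The map `M → M ⊗_{R⟦z⟧} K^sep⟦z⟧`, `m ↦ m ⊗ 1`. -/
def toSepFibre : M.carrier →ₛₗ[toSep R Ks] SepFibre Ks M :=
  BaseChange.of (toSep R Ks) M.carrier

variable {Ks} in
/-- The canonical map `M[1/(z - ζ)] → M ⊗_{R⟦z⟧} K^sep⟦z⟧`. -/
def locToSepFibre (hζ : algebraMap R Ks ζ ≠ 0) :
    BaseChange (toLoc ζ) M.carrier →ₛₗ[locToSep hζ] SepFibre Ks M :=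
  BaseChange.lift (locToSep hζ)
    { toFun := toSepFibre Ks M
      map_add' := map_add _
      map_smul' := fun a m => by
        rw [LinearMap.map_smulₛₗ, RingHom.comp_apply, locToSep_toLoc] }

variable [Algebra 𝔽 Ks]

/-- `M ⊗_{R⟦z⟧} K^sep⟦z⟧` as a module over `𝔽⟦z⟧ ⊆ K^sep⟦z⟧`. -/
instance : Module 𝔽⟦X⟧ (SepFibre Ks M) :=
  Module.compHom _ (toSep 𝔽 Ks)

theorem smul_def (a : 𝔽⟦X⟧) (x : SepFibre Ks M) : a • x = toSep 𝔽 Ks a • x := rfl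

theorem sigmaHat_toSep (a : R⟦X⟧) :
    sigmaHat 𝔽 Ks (toSep R Ks a) = toSep R Ks (sigmaHat 𝔽 R a) := by
  ext n
  simp [sigmaHat]

theorem sigmaHat_toSep_self (a : 𝔽⟦X⟧) : sigmaHat 𝔽 Ks (toSep 𝔽 Ks a) = toSep 𝔽 Ks a := by
  ext n
  simp [sigmaHat]

variable {Ks}

/-- The `σ̂`-semilinear endomorphism `m ↦ τ(σ̂^*m)` of `M ⊗_{R⟦z⟧} K^sep⟦z⟧`, that is
`m ⊗ f ↦ σ̂(f) • τ(σ̂^*m)`. -/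
def frob (hζ : algebraMap R Ks ζ ≠ 0) : SepFibre Ks M →ₛₗ[sigmaHat 𝔽 Ks] SepFibre Ks M :=
  BaseChange.lift (sigmaHat 𝔽 Ks)
    { toFun := fun m => locToSepFibre M hζ (M.tauMap m)
      map_add' := fun x y => by rw [map_add, map_add]
      map_smul' := fun a m => by
        rw [LinearMap.map_smulₛₗ, LinearMap.map_smulₛₗ, RingHom.comp_apply, RingHom.comp_apply,
          locToSep_toLoc, sigmaHat_toSep] }

theorem frob_toSepFibre (hζ : algebraMap R Ks ζ ≠ 0) (m : M.carrier) :
    M.frob hζ (toSepFibre Ks M m) = locToSepFibre M hζ (M.tauMap m) :=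
  BaseChange.lift_of _ _ m

/-- The (dual) Tate module `{m ∈ M ⊗_{R⟦z⟧} K^sep⟦z⟧ | τ(σ̂^*m) = m}`, an `𝔽⟦z⟧`-module. -/
def tateModule (hζ : algebraMap R Ks ζ ≠ 0) : Submodule 𝔽⟦X⟧ (SepFibre Ks M) where
  carrier := {m | M.frob hζ m = m}
  add_mem' {x y} hx hy := by
    rw [Set.mem_ofPred_eq] at hx hy ⊢
    rw [map_add, hx, hy]
  zero_mem' := map_zero (M.frob hζ)
  smul_mem' a x hx := by
    rw [Set.mem_ofPred_eq] at hx ⊢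
    rw [smul_def, LinearMap.map_smulₛₗ, hx, sigmaHat_toSep_self]

end Fibre

section Galois

variable {K Ks : Type*} [Field K] [Algebra R K] [Field Ks] [Algebra K Ks] [Algebra R Ks]
  [IsScalarTower R K Ks] (M : LocalShtuka 𝔽 ζ)

/-- The coefficientwise action of `g ∈ Gal(K^sep/K)` on `K^sep⟦z⟧`. -/
def galPS {K Ks : Type*} [Field K] [Field Ks] [Algebra K Ks] (g : Ks ≃ₐ[K] Ks) :
    Ks⟦X⟧ →+* Ks⟦X⟧ :=
  PowerSeries.map (g : Ks →+* Ks)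

theorem galPS_toSep (g : Ks ≃ₐ[K] Ks) (a : R⟦X⟧) : galPS g (toSep R Ks a) = toSep R Ks a := by
  ext n
  simp [galPS, IsScalarTower.algebraMap_apply R K Ks]

theorem galPS_locToSep (hζ : algebraMap R Ks ζ ≠ 0) (g : Ks ≃ₐ[K] Ks) (s : Loc ζ) :
    galPS g (locToSep hζ s) = locToSep hζ s := by
  have h : (galPS g).comp (locToSep hζ) = locToSep hζ := by
    refine IsLocalization.ringHom_ext (Submonoid.powers (PowerSeries.X - PowerSeries.C ζ : R⟦X⟧)) (RingHom.ext fun a => ?_)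
    change galPS g (locToSep hζ (toLoc ζ a)) = locToSep hζ (toLoc ζ a)
    rw [locToSep_toLoc, galPS_toSep]
  exact RingHom.congr_fun h s

/-- The action of `g ∈ Gal(K^sep/K)` on `M ⊗_{R⟦z⟧} K^sep⟦z⟧`, `m ⊗ f ↦ m ⊗ g(f)`. -/
def galFibre (g : Ks ≃ₐ[K] Ks) : SepFibre Ks M →ₛₗ[galPS g] SepFibre Ks M :=
  BaseChange.lift (galPS g)
    { toFun := toSepFibre Ks M
      map_add' := map_add _
      map_smul' := fun a m => by
        rw [LinearMap.map_smulₛₗ, RingHom.comp_apply, galPS_toSep] }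

theorem galFibre_toSepFibre (g : Ks ≃ₐ[K] Ks) (m : M.carrier) :
    M.galFibre g (toSepFibre Ks M m) = toSepFibre Ks M m :=
  BaseChange.lift_of _ _ m

theorem SepFibre.induction_on {M : LocalShtuka 𝔽 ζ} {P : SepFibre Ks M → Prop}
    (x : SepFibre Ks M) (zero : P 0)
    (smul_of : ∀ (b : Ks⟦X⟧) (m : M.carrier), P (b • toSepFibre Ks M m))
    (add : ∀ x y, P x → P y → P (x + y)) : P x :=
  BaseChange.induction_on (f := toSep R Ks) (P := P) x zero smul_of add

theorem galFibre_one (x : SepFibre Ks M) : M.galFibre (1 : Ks ≃ₐ[K] Ks) x = x := by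
  refine SepFibre.induction_on (P := fun x => M.galFibre (1 : Ks ≃ₐ[K] Ks) x = x) x
    (map_zero _) (fun b m => ?_) (fun x y hx hy => by rw [map_add, hx, hy])
  rw [LinearMap.map_smulₛₗ, galFibre_toSepFibre]
  congr 1

theorem galFibre_mul (g h : Ks ≃ₐ[K] Ks) (x : SepFibre Ks M) :
    M.galFibre (g * h) x = M.galFibre g (M.galFibre h x) := by
  refine SepFibre.induction_on
    (P := fun x => M.galFibre (g * h) x = M.galFibre g (M.galFibre h x)) x
    (by rw [map_zero, map_zero, map_zero]) (fun b m => ?_)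
    (fun x y hx hy => by rw [map_add, map_add, map_add, hx, hy])
  rw [LinearMap.map_smulₛₗ, LinearMap.map_smulₛₗ, LinearMap.map_smulₛₗ]
  simp only [galFibre_toSepFibre]
  congr 1

theorem galFibre_locToSepFibre (hζ : algebraMap R Ks ζ ≠ 0) (g : Ks ≃ₐ[K] Ks)
    (y : BaseChange (toLoc ζ) M.carrier) :
    M.galFibre g (locToSepFibre M hζ y) = locToSepFibre M hζ y := by
  refine BaseChange.induction_on
    (P := fun y => M.galFibre g (locToSepFibre M hζ y) = locToSepFibre M hζ y) y
    (by rw [map_zero, map_zero]) (fun s m => ?_)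
    (fun x y hx hy => by rw [map_add, map_add, hx, hy])
  have e : locToSepFibre M hζ (BaseChange.of (toLoc ζ) _ m) = toSepFibre Ks M m :=
    BaseChange.lift_of _ _ m
  rw [LinearMap.map_smulₛₗ, LinearMap.map_smulₛₗ, e, galFibre_toSepFibre, galPS_locToSep]

variable [Algebra 𝔽 Ks]

theorem galFibre_frob (hζ : algebraMap R Ks ζ ≠ 0) (g : Ks ≃ₐ[K] Ks) (x : SepFibre Ks M) :
    M.galFibre g (M.frob hζ x) = M.frob hζ (M.galFibre g x) := by
  refine SepFibre.induction_on
    (P := fun x => M.galFibre g (M.frob hζ x) = M.frob hζ (M.galFibre g x)) x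
    (by simp only [map_zero]) (fun b m => ?_)
    (fun x y hx hy => by simp only [map_add, hx, hy])
  rw [LinearMap.map_smulₛₗ, LinearMap.map_smulₛₗ, LinearMap.map_smulₛₗ, LinearMap.map_smulₛₗ,
    galFibre_toSepFibre, frob_toSepFibre, galFibre_locToSepFibre]
  congr 1
  ext n
  simp [galPS, sigmaHat]

variable [IsScalarTower 𝔽 R Ks]

theorem galPS_toSep_const (R : Type*) [CommRing R] [Algebra 𝔽 R] [Algebra R K] [Algebra R Ks]
    [IsScalarTower R K Ks] [IsScalarTower 𝔽 R Ks] (g : Ks ≃ₐ[K] Ks) (a : 𝔽⟦X⟧) :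
    galPS g (toSep 𝔽 Ks a) = toSep 𝔽 Ks a := by
  ext n
  simp [galPS, IsScalarTower.algebraMap_apply 𝔽 R Ks, IsScalarTower.algebraMap_apply R K Ks]

/-- The Galois representation `Gal(K^sep/K) → Aut_{𝔽⟦z⟧}(T)` on the Tate module `T` of `M`. -/
def galoisRep (hζ : algebraMap R Ks ζ ≠ 0) :
    Representation 𝔽⟦X⟧ (Ks ≃ₐ[K] Ks) (M.tateModule hζ) where
  toFun g :=
    { toFun := fun x => ⟨M.galFibre g x, by
        change M.frob hζ (M.galFibre g x) = M.galFibre g x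
        rw [← galFibre_frob]
        exact congrArg _ x.2⟩
      map_add' := fun x y => Subtype.ext (map_add (M.galFibre g) (x : SepFibre Ks M) y)
      map_smul' := fun a x => Subtype.ext (by
        change M.galFibre g (a • (x : SepFibre Ks M)) = a • M.galFibre g x
        rw [smul_def, LinearMap.map_smulₛₗ, galPS_toSep_const R, smul_def]) }
  map_one' := LinearMap.ext fun x => Subtype.ext (M.galFibre_one (K := K) (x : SepFibre Ks M))
  map_mul' g h := LinearMap.ext fun x => Subtype.ext (M.galFibre_mul g h (x : SepFibre Ks M))

/-- The Galois representation `Gal(K^sep/K) → GL_r(𝔽⟦z⟧)` of `M` with respect to an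
`𝔽⟦z⟧`-basis `b` of its Tate module. -/
def galoisRepGL (hζ : algebraMap R Ks ζ ≠ 0) {r : ℕ}
    (b : Module.Basis (Fin r) 𝔽⟦X⟧ (M.tateModule hζ)) :
    (Ks ≃ₐ[K] Ks) →* GL (Fin r) 𝔽⟦X⟧ :=
  (Units.map (LinearMap.toMatrixAlgEquiv b : _ →* Matrix (Fin r) (Fin r) 𝔽⟦X⟧)).comp
    (M.galoisRep (K := K) hζ).toHomUnits

end Galois

end Tate

end LocalShtuka

/-- The `z`-adic topology on `GL_r(𝔽⟦z⟧)`: the unit group topology coming from the product topology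
on matrices, where `𝔽⟦z⟧` has the topology of coefficientwise convergence and `𝔽` is discrete. -/
abbrev zAdicTopologyGL (𝔽 : Type*) [Field 𝔽] (r : ℕ) : TopologicalSpace (GL (Fin r) 𝔽⟦X⟧) :=
  letI : TopologicalSpace 𝔽 := ⊥
  letI : TopologicalSpace 𝔽⟦X⟧ := PowerSeries.WithPiTopology.instTopologicalSpace 𝔽
  (Units.instTopologicalSpaceUnits : TopologicalSpace (Matrix (Fin r) (Fin r) 𝔽⟦X⟧)ˣ)

end Shtuka

end

/-! The obstruction already sits in the determinant of `ρ`. By Lang's theorem over `K^sep⟦z⟧`, the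
Frobenius of `M ⊗ K^sep⟦z⟧` has a basis of fixed vectors (`exists_basis_fixed`), and this is a basis
of the Tate module (`tateBasis`). Let `V` be the matrix of a Tate basis in a basis coming from `M`,
and put `u = det V`. Then `det τ · σ̂(u) = u` and `g(u) = u · det ρ(g)`. Since `p ∣ d`, `det τ = wᵖ
c` with `w` a power of `z - ζ` and `c` a unit of `R⟦z⟧`.

The logarithmic derivative in `z` kills `wᵖ` and turns these equations into additive ones. The
coefficients `ψₙ` of `u'/u` solve the Artin-Schreier equations `ψₙ - ψₙ^q = cₙ`, where `cₙ ∈ R` are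
the coefficients of `c'/c`, and `g` translates `ψₙ` by the `n`-th coefficient of the logarithmic
derivative of `det ρ(g)`.

As the residue field is algebraic over `𝔽`, the cokernel of `y ↦ y - y^q` on `R` has dimension at
most one over `𝔽` (`exists_smul_add_smul_eq_sub_pow_of_isAdicComplete`). So any two coefficients of
the logarithmic derivative of `det ρ(g)` satisfy a non-trivial linear relation that does not depend
on `g` (`exists_linear_relation_coeff_logDerivative`). An open image would contain `diag(1 +
z^(n+1), 1, …, 1)` for all large `n`, and for `p ∣ n` these have logarithmic derivative `zⁿ + …`,
which contradicts such a relation. -/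

noncomputable section

/-! ### Frobenius-semilinear algebra over a separably closed field -/

section Lang

variable (𝔽 : Type*) [Field 𝔽] [Fintype 𝔽] {L : Type*} [Field L] [Algebra 𝔽 L]

/-- The Frobenius `x ↦ x ^ q` of an `𝔽`-algebra as a ring endomorphism. -/
abbrev frobHom (B : Type*) [CommRing B] [Algebra 𝔽 B] : B →+* B :=
  (FiniteField.frobeniusAlgHom 𝔽 B : B →+* B)

theorem frobHom_apply {B : Type*} [CommRing B] [Algebra 𝔽 B] (x : B) :
    frobHom 𝔽 B x = x ^ Fintype.card 𝔽 := rfl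

theorem natCast_card_eq_zero (B : Type*) [CommRing B] [Algebra 𝔽 B] :
    ((Fintype.card 𝔽 : ℕ) : B) = 0 := by
  rw [← map_natCast (algebraMap 𝔽 B), FiniteField.cast_card_eq_zero, map_zero]

/-- An element of an extension field of `𝔽` fixed by the Frobenius lies in `𝔽`. -/
theorem mem_range_algebraMap_of_pow_card {x : L} (hx : x ^ Fintype.card 𝔽 = x) :
    ∃ a : 𝔽, algebraMap 𝔽 L a = x := by
  have hprod : (Finset.univ.val.map fun a : 𝔽 => Polynomial.X - Polynomial.C a).prod =
      Polynomial.X ^ Fintype.card 𝔽 - Polynomial.X := by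
    have hmonic : (Polynomial.X ^ Fintype.card 𝔽 - Polynomial.X : Polynomial 𝔽).Monic :=
      Polynomial.monic_X_pow_sub (by
        rw [Polynomial.degree_X]; exact_mod_cast Fintype.one_lt_card (α := 𝔽))
    have h := Polynomial.prod_multiset_X_sub_C_of_monic_of_roots_card_eq hmonic (by
      rw [FiniteField.roots_X_pow_card_sub_X,
        FiniteField.X_pow_card_sub_X_natDegree_eq _ Fintype.one_lt_card]
      rfl)
    rwa [FiniteField.roots_X_pow_card_sub_X] at h
  have h := congrArg (Polynomial.aeval x) hprod
  rw [map_multiset_prod, Multiset.map_map] at h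
  simp only [map_sub, map_pow, Polynomial.aeval_X, hx, sub_self, Multiset.prod_eq_zero_iff,
    Multiset.mem_map, Function.comp_apply, Polynomial.aeval_C] at h
  obtain ⟨a, -, ha⟩ := h
  exact ⟨a, (sub_eq_zero.1 ha).symm⟩

theorem separable_of_derivative_eq_neg_one {P : Polynomial L} (h : P.derivative = -1) :
    P.Separable :=
  ⟨0, -1, by rw [h]; ring⟩

theorem exists_sub_pow_card_eq [IsSepClosed L] (b : L) : ∃ x : L, x - x ^ Fintype.card 𝔽 = b := by
  let P : Polynomial L := Polynomial.X ^ Fintype.card 𝔽 - (Polynomial.X - Polynomial.C b)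
  have hd : P.derivative = -1 := by
    simp [P, Polynomial.derivative_X_pow, natCast_card_eq_zero]
  have hdeg : P.degree ≠ 0 := by
    intro h0
    rw [Polynomial.eq_C_of_degree_eq_zero h0, Polynomial.derivative_C] at hd
    simp at hd
  obtain ⟨x, hx⟩ := IsSepClosed.exists_root P hdeg (separable_of_derivative_eq_neg_one hd)
  refine ⟨x, ?_⟩
  simp only [P, Polynomial.IsRoot, Polynomial.eval_sub, Polynomial.eval_pow, Polynomial.eval_X,
    Polynomial.eval_C] at hx
  linear_combination -hx

/-- The additive polynomials `B₀ = a₀ Y ^ q`, `Bₖ₊₁ = Bₖ ^ q + aₖ₊₁ Y ^ q`. -/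
def addPoly (q : ℕ) (a : ℕ → L) : ℕ → Polynomial L
  | 0 => Polynomial.C (a 0) * Polynomial.X ^ q
  | k + 1 => addPoly q a k ^ q + Polynomial.C (a (k + 1)) * Polynomial.X ^ q

theorem X_pow_dvd_addPoly (q : ℕ) (hq : 1 < q) (a : ℕ → L) (k : ℕ) :
    Polynomial.X ^ q ∣ addPoly q a k := by
  induction k with
  | zero => exact Dvd.intro_left _ rfl
  | succ k ih => exact dvd_add (dvd_pow ih (by omega)) (Dvd.intro_left _ rfl)

theorem derivative_addPoly (a : ℕ → L) (k : ℕ) :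
    (addPoly (Fintype.card 𝔽) a k).derivative = 0 := by
  have h := natCast_card_eq_zero 𝔽 L
  cases k <;> simp [addPoly, Polynomial.derivative_pow, h]

/-- The `q`-th power of the preceding polynomial is divisible by `Y^(q²)`, so the coefficient of
`Y^q` is exactly the newest `a`; descend after removing it. -/
theorem eq_zero_of_addPoly_eq_zero (q : ℕ) (hq : 1 < q) (a : ℕ → L) (k : ℕ)
    (h : addPoly q a k = 0) : ∀ i ≤ k, a i = 0 := by
  induction k with
  | zero =>
    intro i hi
    obtain rfl : i = 0 := by omega
    simpa [addPoly] using h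
  | succ k ih =>
    have ha : a (k + 1) = 0 := by
      have hc := congrArg (fun P => Polynomial.coeff P q) h
      obtain ⟨E, hE⟩ := X_pow_dvd_addPoly q hq a k
      have hlt : q < q * q := by nlinarith
      simpa [addPoly, hE, mul_pow, ← pow_mul, Polynomial.coeff_X_pow_mul', hlt.not_ge] using hc
    have hk : addPoly q a k = 0 := by
      have h' := h
      rw [addPoly, ha, Polynomial.C_0, zero_mul, add_zero] at h'
      exact eq_zero_of_pow_eq_zero h'
    intro i hi
    rcases Nat.lt_or_ge i (k + 1) with h1 | h1
    · exact ih hk i (by omega)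
    · obtain rfl : i = k + 1 := by omega
      exact ha

/-- A non-zero additive polynomial without linear term has a non-zero fixed point over a separably
closed field. -/
theorem exists_eval_addPoly_eq_self [IsSepClosed L] (a : ℕ → L) (k : ℕ) (ha : ∃ i ≤ k, a i ≠ 0) :
    ∃ t : L, t ≠ 0 ∧ (addPoly (Fintype.card 𝔽) a k).eval t = t := by
  set q := Fintype.card 𝔽 with hqdef
  have hq : 1 < q := Fintype.one_lt_card
  obtain ⟨E, hE⟩ := X_pow_dvd_addPoly q hq a k
  have hE0 : E ≠ 0 := by
    rintro rfl
    obtain ⟨i, hi, hai⟩ := ha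
    exact hai (eq_zero_of_addPoly_eq_zero q hq a k (by rw [hE, mul_zero]) i hi)
  -- Dividing the additive polynomial minus `Y` by `Y` removes the root `0`: the quotient has
  -- constant term `-1`, and it is separable because its multiple by `Y` has derivative `-1`.
  let Q : Polynomial L := Polynomial.X ^ (q - 1) * E - 1
  have hXQ : Polynomial.X * Q = addPoly q a k - Polynomial.X := by
    rw [hE, show (Polynomial.X : Polynomial L) ^ q = Polynomial.X * Polynomial.X ^ (q - 1) by
      rw [← pow_succ', Nat.sub_add_cancel hq.le]]
    simp only [Q]; ring
  have hsep : Q.Separable := by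
    refine Polynomial.Separable.of_mul_right (f := Polynomial.X) ?_
    refine separable_of_derivative_eq_neg_one ?_
    rw [hXQ, Polynomial.derivative_sub, derivative_addPoly 𝔽, Polynomial.derivative_X, zero_sub]
  have hdeg : Q.degree ≠ 0 := by
    intro h0
    have h1 : (Polynomial.X ^ (q - 1) * E) = Polynomial.C (Q.coeff 0 + 1) := by
      rw [Polynomial.C_add, ← Polynomial.eq_C_of_degree_eq_zero h0]; simp [Q]
    have h2 := congrArg Polynomial.natDegree h1
    rw [Polynomial.natDegree_C, Polynomial.natDegree_mul (pow_ne_zero _ Polynomial.X_ne_zero) hE0,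
      Polynomial.natDegree_X_pow] at h2
    omega
  obtain ⟨t, ht⟩ := IsSepClosed.exists_root Q hdeg hsep
  refine ⟨t, ?_, ?_⟩
  · rintro rfl
    have : q - 1 ≠ 0 := by omega
    simp [Q, Polynomial.IsRoot, this] at ht
  · have h := congrArg (Polynomial.eval t) hXQ
    rw [Polynomial.eval_mul, ht.eq_zero, mul_zero, Polynomial.eval_sub, Polynomial.eval_X] at h
    exact (sub_eq_zero.1 h.symm)

variable {𝔽} {V : Type*} [AddCommGroup V] [Module L V]

/-- The kernel of the `n`-th iterate of a Frobenius-semilinear endomorphism. -/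
def iterateKer (φ : V →ₛₗ[frobHom 𝔽 L] V) (n : ℕ) : Submodule L V where
  carrier := {x | φ^[n] x = 0}
  add_mem' {x y} hx hy := by
    change φ^[n] (x + y) = 0
    rw [iterate_map_add, show φ^[n] x = 0 from hx, show φ^[n] y = 0 from hy, add_zero]
  zero_mem' := iterate_map_zero φ n
  smul_mem' c x hx := by
    have h : ∀ n, ∃ c' : L, φ^[n] (c • x) = c' • φ^[n] x := by
      intro n
      induction n with
      | zero => exact ⟨c, rfl⟩
      | succ n ih =>
        obtain ⟨c', hc'⟩ := ih
        exact ⟨_, by rw [Function.iterate_succ_apply', hc', LinearMap.map_smulₛₗ,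
          ← Function.iterate_succ_apply' φ]⟩
    obtain ⟨c', hc'⟩ := h n
    change φ^[n] (c • x) = 0
    rw [hc', show φ^[n] x = 0 from hx, smul_zero]

/-- If `φ^(n+1) = 0`, the image of `φ`, and hence its span `V`, lies in the kernel of `φ^n`; descend
to `n = 0`. -/
theorem iterateKer_ne_top [Nontrivial V] (φ : V →ₛₗ[frobHom 𝔽 L] V)
    (hφ : Submodule.span L (Set.range φ) = ⊤) (n : ℕ) : iterateKer φ n ≠ ⊤ := by
  induction n with
  | zero =>
    intro h
    obtain ⟨x, hx⟩ := exists_ne (0 : V)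
    exact hx (show x ∈ iterateKer φ 0 from h ▸ Submodule.mem_top)
  | succ n ih =>
    intro h
    refine ih (top_le_iff.1 (hφ ▸ Submodule.span_le.2 ?_))
    rintro _ ⟨x, rfl⟩
    exact show x ∈ iterateKer φ (n + 1) from h ▸ Submodule.mem_top

/-- The kernels of the iterates form an ascending chain that stabilizes, so their union is one of
them and therefore proper. -/
theorem exists_forall_iterate_ne_zero [Nontrivial V] [FiniteDimensional L V]
    (φ : V →ₛₗ[frobHom 𝔽 L] V) (hφ : Submodule.span L (Set.range φ) = ⊤) :
    ∃ v : V, ∀ n, φ^[n] v ≠ 0 := by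
  have hmono : Monotone (iterateKer φ) := monotone_nat_of_le_succ fun n x hx => by
    change φ^[n + 1] x = 0
    rw [Function.iterate_succ_apply', show φ^[n] x = 0 from hx, map_zero]
  obtain ⟨n, hn⟩ := monotone_stabilizes_iff_noetherian.2 (inferInstance : IsNoetherian L V)
    ⟨iterateKer φ, hmono⟩
  obtain ⟨v, hv⟩ := SetLike.exists_not_mem_of_ne_top _ (iterateKer_ne_top φ hφ n) rfl
  refine ⟨v, fun m hm => hv ?_⟩
  rcases le_total n m with h | h
  · have := hn m h
    simp only [OrderHom.coe_mk] at this
    rw [this]; exact hm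
  · exact hmono h hm

/-- Over a separably closed field, a Frobenius-semilinear endomorphism whose image spans a non-zero
space has a non-zero fixed vector. -/
theorem exists_fixed_ne_zero [IsSepClosed L] [Nontrivial V] [FiniteDimensional L V]
    (φ : V →ₛₗ[frobHom 𝔽 L] V) (hφ : Submodule.span L (Set.range φ) = ⊤) :
    ∃ w : V, w ≠ 0 ∧ φ w = w := by
  classical
  obtain ⟨v, hv⟩ := exists_forall_iterate_ne_zero φ hφ
  let W : ℕ → Submodule L V := fun n => Submodule.span L (Set.range fun i : Fin n => φ^[i] v)
  have hmemW : ∀ {i n : ℕ}, i < n → φ^[i] v ∈ W n := fun {i n} h =>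
    Submodule.subset_span ⟨⟨i, h⟩, rfl⟩
  have hmono : Monotone W := fun m n h => Submodule.span_le.2 (by
    rintro _ ⟨i, rfl⟩
    exact hmemW (i.2.trans_le h))
  have hex : ∃ m, φ^[m] v ∈ W m := by
    obtain ⟨n, hn⟩ := monotone_stabilizes_iff_noetherian.2 (inferInstance : IsNoetherian L V)
      ⟨W, hmono⟩
    refine ⟨n, ?_⟩
    have h := hn (n + 1) n.le_succ
    simp only [OrderHom.coe_mk] at h
    rw [h]
    exact hmemW n.lt_succ_self
  -- `k + 1` is the first exponent at which an iterate of `v` depends on the earlier ones.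
  obtain ⟨k, hk⟩ : ∃ k, Nat.find hex = k + 1 := Nat.exists_eq_succ_of_ne_zero fun h0 => by
    have h := Nat.find_spec hex
    rw [h0] at h
    simp only [W, Set.range_eq_empty, Submodule.span_empty, Submodule.mem_bot] at h
    exact hv 0 h
  have hspec : φ^[k + 1] v ∈ W (k + 1) := hk ▸ Nat.find_spec hex
  have hmin : φ^[k] v ∉ W k := Nat.find_min hex (by omega)
  obtain ⟨a', ha'⟩ := (Submodule.mem_span_range_iff_exists_fun L).1 hspec
  obtain ⟨a, ha⟩ : ∃ a : ℕ → L, ∀ i : Fin (k + 1), a i = a' i :=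
    ⟨fun n => if h : n < k + 1 then a' ⟨n, h⟩ else 0, fun i => dif_pos i.2⟩
  have hsum : ∑ i ∈ Finset.range (k + 1), a i • φ^[i] v = φ^[k + 1] v := by
    rw [Finset.sum_range, ← ha']
    exact Finset.sum_congr rfl fun i _ => by rw [ha]
  have hane : ∃ i ≤ k, a i ≠ 0 := by
    by_contra! h
    refine hv (k + 1) (hsum ▸ Finset.sum_eq_zero fun i hi => ?_)
    rw [h i (by have := Finset.mem_range.1 hi; omega), zero_smul]
  obtain ⟨t, ht0, ht⟩ := exists_eval_addPoly_eq_self 𝔽 a k hane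
  set q := Fintype.card 𝔽
  -- Invariance of `∑ bᵢ φⁱ(v)` follows from `b₀ = a₀ b_k^q` and `bᵢ₊₁ = bᵢ^q + aᵢ₊₁ b_k^q`. With
  -- `b_k = t` this recursion is the definition of `addPoly` evaluated at `t`, and it closes up
  -- because `t` is a fixed point.
  let b : ℕ → L := fun i => (addPoly q a i).eval t
  have hb0 : b 0 = a 0 * t ^ q := by simp [b, addPoly]
  have hb1 : ∀ i, b (i + 1) = b i ^ q + a (i + 1) * t ^ q := fun i => by simp [b, addPoly]
  have hbk : b k = t := ht
  refine ⟨∑ i ∈ Finset.range (k + 1), b i • φ^[i] v, fun h0 => hmin ?_, ?_⟩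
  · rw [Finset.sum_range_succ, hbk] at h0
    have h1 : φ^[k] v = t⁻¹ • (-∑ i ∈ Finset.range k, b i • φ^[i] v) := by
      rw [← eq_neg_of_add_eq_zero_right h0, smul_smul, inv_mul_cancel₀ ht0, one_smul]
    rw [h1]
    exact Submodule.smul_mem _ _ (Submodule.neg_mem _ (Submodule.sum_mem _ fun i hi =>
      Submodule.smul_mem _ _ (hmemW (Finset.mem_range.1 hi))))
  · have h1 : φ (∑ i ∈ Finset.range (k + 1), b i • φ^[i] v) =
        ∑ i ∈ Finset.range (k + 1), b i ^ q • φ^[i + 1] v := by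
      rw [map_sum]
      refine Finset.sum_congr rfl fun i _ => ?_
      rw [LinearMap.map_smulₛₗ, frobHom_apply, ← Function.iterate_succ_apply' φ]
    rw [h1, Finset.sum_range_succ, hbk, ← hsum, Finset.sum_range_succ', smul_add, Finset.smul_sum,
      Finset.sum_range_succ' (fun i => b i • φ^[i] v), hb0, ← add_assoc, ← Finset.sum_add_distrib,
      smul_smul, mul_comm (t ^ q)]
    congr 1
    refine Finset.sum_congr rfl fun i _ => ?_
    rw [hb1, add_smul, smul_smul, mul_comm (t ^ q)]

/-- Over a separably closed field, a Frobenius-semilinear endomorphism of a finite-dimensional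
space whose image is spanning has a spanning set of fixed vectors. -/
theorem span_fixed_eq_top [IsSepClosed L] [FiniteDimensional L V]
    (φ : V →ₛₗ[frobHom 𝔽 L] V) (hφ : Submodule.span L (Set.range φ) = ⊤) :
    Submodule.span L {w | φ w = w} = ⊤ := by
  set W := Submodule.span L {w | φ w = w} with hW
  -- On multiples of a fixed vector `w`, solving `x - φ(x) = c w` is the Artin-Schreier equation in
  -- the scalar.
  have hsurj : ∀ y ∈ W, ∃ x ∈ W, x - φ x = y := by
    intro y hy
    rw [hW, Finsupp.mem_span_iff_linearCombination] at hy
    obtain ⟨l, rfl⟩ := hy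
    induction l using Finsupp.induction_linear with
    | zero => exact ⟨0, W.zero_mem, by simp⟩
    | add f g hf hg =>
      obtain ⟨x, hx, hxf⟩ := hf
      obtain ⟨y, hy, hyg⟩ := hg
      exact ⟨x + y, W.add_mem hx hy, by rw [map_add, map_add, ← hxf, ← hyg]; abel⟩
    | single w c =>
      obtain ⟨x, hx⟩ := exists_sub_pow_card_eq 𝔽 c
      refine ⟨x • (w : V), W.smul_mem _ (Submodule.subset_span w.2), ?_⟩
      have hw : φ (w : V) = w := w.2
      rw [LinearMap.map_smulₛₗ, hw, frobHom_apply, ← sub_smul, hx,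
        Finsupp.linearCombination_single]
  have hle : W ≤ W.comap φ := Submodule.span_le.2 fun w hw => by
    change φ w ∈ W
    rw [show φ w = w from hw]
    exact Submodule.subset_span hw
  by_contra hne
  have : Nontrivial (V ⧸ W) := Submodule.Quotient.nontrivial_iff.2 hne
  have hspan : Submodule.span L (Set.range (W.mapQ W φ hle)) = ⊤ := by
    have h := congrArg (Submodule.map W.mkQ) hφ
    rw [Submodule.map_span, Submodule.map_top, Submodule.range_mkQ] at h
    rw [eq_top_iff, ← h, Submodule.span_le]
    rintro _ ⟨_, ⟨x, rfl⟩, rfl⟩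
    exact Submodule.subset_span ⟨W.mkQ x, rfl⟩
  -- A fixed vector of `V/W` lifts to a fixed vector of `V` after correction by an element of `W`,
  -- hence lies in `W`, a contradiction.
  obtain ⟨w, hw0, hw⟩ := exists_fixed_ne_zero _ hspan
  obtain ⟨w, rfl⟩ := W.mkQ_surjective w
  have h1 : φ w - w ∈ W := by
    rw [← Submodule.Quotient.mk_eq_zero, Submodule.Quotient.mk_sub, sub_eq_zero]
    exact hw
  obtain ⟨x, hx, hxw⟩ := hsurj _ h1
  refine hw0 ((Submodule.Quotient.mk_eq_zero W).2 ?_)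
  have h2 : w + x ∈ W := Submodule.subset_span (show φ (w + x) = w + x by
    rw [map_add, show φ w + φ x = φ w - w + φ x + w by abel, ← hxw]; abel)
  simpa using W.sub_mem h2 hx

/-- **Lang's theorem** for `GLₙ` over a separably closed field. -/
theorem exists_isUnit_mul_map_frobHom_eq [IsSepClosed L] {r : ℕ} (A : Matrix (Fin r) (Fin r) L)
    (hA : IsUnit A.det) :
    ∃ U : Matrix (Fin r) (Fin r) L, IsUnit U.det ∧ A * U.map (frobHom 𝔽 L) = U := by
  -- The columns of `U` will be a basis of fixed vectors of `x ↦ A · x^(q)`.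
  let φ : (Fin r → L) →ₛₗ[frobHom 𝔽 L] (Fin r → L) :=
    { toFun := fun x => A.mulVec (frobHom 𝔽 L ∘ x)
      map_add' := fun x y => by
        rw [← Matrix.mulVec_add]; congr 1; ext i; simp only [Function.comp, Pi.add_apply, map_add]
      map_smul' := fun c x => by
        rw [← Matrix.mulVec_smul]; congr 1; ext i
        simp only [Function.comp, Pi.smul_apply, smul_eq_mul, map_mul] }
  have hφ : Submodule.span L (Set.range φ) = ⊤ := by
    rw [eq_top_iff]
    rintro y -
    have hy : y = ∑ i, (A⁻¹.mulVec y) i • φ (Pi.single i 1) := by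
      have h1 : ∀ i, φ (Pi.single i 1) = A.mulVec (Pi.single i 1) := fun i => by
        change A.mulVec _ = _
        congr 1; ext j
        by_cases h : j = i
        · subst h; simp
        · simp [h]
      simp_rw [h1, ← Matrix.mulVec_smul]
      rw [← Matrix.mulVec_sum]
      conv_lhs => rw [← Matrix.one_mulVec y, ← Matrix.mul_nonsing_inv A hA, ← Matrix.mulVec_mulVec]
      congr 1
      exact pi_eq_sum_univ' _
    rw [hy]
    exact Submodule.sum_mem _ fun i _ => Submodule.smul_mem _ _ (Submodule.subset_span ⟨_, rfl⟩)
  have hs : ⊤ ≤ Submodule.span L {w | φ w = w} := (span_fixed_eq_top φ hφ).ge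
  let b := Module.Basis.ofSpan hs
  have : Fintype _ := Module.Basis.fintypeIndexOfRankLtAleph0 b (Module.rank_lt_aleph0 _ _)
  let b' := b.reindex (Fintype.equivOfCardEq (β := Fin r)
    (by rw [← Module.finrank_eq_card_basis b]; simp))
  have hb' : ∀ j, φ (b' j) = b' j := fun j => by
    rw [Module.Basis.reindex_apply]
    exact Module.Basis.ofSpan_subset hs ⟨_, rfl⟩
  refine ⟨(Pi.basisFun L (Fin r)).toMatrix b', ?_, ?_⟩
  · exact Matrix.isUnit_det_of_right_inverse
      ((Pi.basisFun L (Fin r)).toMatrix_mul_toMatrix_flip b')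
  · ext i j
    exact congrFun (hb' j) i

end Lang

/-! ### Lang's theorem for power series, one coefficient at a time. -/

section LangPowerSeries

variable {𝔽 : Type*} [Field 𝔽] [Fintype 𝔽] {L : Type*} [Field L] [Algebra 𝔽 L]

/-- The coefficients of a solution `U = ∑ Uₙ zⁿ` of `A * σ̂(U) = U`, given its constant term `U₀`
and a section `as` of `x ↦ x - x ^ q`. -/
def langCoeff {r : ℕ} (𝔽 : Type*) [Field 𝔽] [Fintype 𝔽] [Algebra 𝔽 L]
    (A : ℕ → Matrix (Fin r) (Fin r) L) (U₀ : Matrix (Fin r) (Fin r) L)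
    (as : L → L) : ℕ → Matrix (Fin r) (Fin r) L
  | 0 => U₀
  | n + 1 => U₀ * (U₀⁻¹ * ∑ i : Fin (n + 1),
      A (n + 1 - i) * (langCoeff 𝔽 A U₀ as i).map (frobHom 𝔽 L)).map as
termination_by n => n
decreasing_by exact i.2

/-- Writing `Uₙ = U₀ Y` and using `A₀ σ(U₀) = U₀`, the equation for `Uₙ` becomes `Y - σ(Y) = U₀⁻¹ S`
with `S` built from earlier coefficients; this splits into Artin-Schreier equations for the entries.
-/
theorem langCoeff_eq {r : ℕ} (A : ℕ → Matrix (Fin r) (Fin r) L) (U₀ : Matrix (Fin r) (Fin r) L)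
    (hU₀ : IsUnit U₀.det) (hA : A 0 * U₀.map (frobHom 𝔽 L) = U₀) (as : L → L)
    (has : ∀ b, as b - as b ^ Fintype.card 𝔽 = b) (n : ℕ) :
    ∑ i ∈ Finset.range (n + 1), A (n - i) * (langCoeff 𝔽 A U₀ as i).map (frobHom 𝔽 L) =
      langCoeff 𝔽 A U₀ as n := by
  cases n with
  | zero => simpa [langCoeff] using hA
  | succ n =>
    rw [Finset.sum_range_succ, Nat.sub_self, Finset.sum_range]
    have h := langCoeff.eq_2 𝔽 A U₀ as n
    set S := ∑ i : Fin (n + 1), A (n + 1 - i) * (langCoeff 𝔽 A U₀ as i).map (frobHom 𝔽 L) with hS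
    have h1 : (U₀⁻¹ * S).map as - ((U₀⁻¹ * S).map as).map (frobHom 𝔽 L) = U₀⁻¹ * S := by
      ext i j
      exact has _
    rw [h, Matrix.map_mul, ← Matrix.mul_assoc, hA]
    rw [← eq_sub_iff_add_eq, ← Matrix.mul_sub, h1, ← Matrix.mul_assoc,
      Matrix.mul_nonsing_inv _ hU₀, Matrix.one_mul]

theorem isUnit_det_iff_constantCoeff {r : ℕ} (A : Matrix (Fin r) (Fin r) L⟦X⟧) :
    IsUnit A.det ↔ IsUnit (A.map (PowerSeries.constantCoeff (R := L))).det := by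
  rw [PowerSeries.isUnit_iff_constantCoeff, RingHom.map_det]
  rfl

/-- **Lang's theorem** for `GLₙ(L⟦z⟧)` over a separably closed field `L`. -/
theorem exists_isUnit_mul_map_sigmaHat_eq [IsSepClosed L] {r : ℕ}
    (A : Matrix (Fin r) (Fin r) L⟦X⟧) (hA : IsUnit A.det) :
    ∃ U : Matrix (Fin r) (Fin r) L⟦X⟧, IsUnit U.det ∧ A * U.map (sigmaHat 𝔽 L) = U := by
  obtain ⟨U₀, hU₀, hAU⟩ := exists_isUnit_mul_map_frobHom_eq (𝔽 := 𝔽)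
    (A.map (PowerSeries.constantCoeff (R := L))) ((isUnit_det_iff_constantCoeff A).1 hA)
  choose as has using exists_sub_pow_card_eq 𝔽 (L := L)
  let A' : ℕ → Matrix (Fin r) (Fin r) L := fun n => A.map (PowerSeries.coeff n)
  let U' := langCoeff 𝔽 A' U₀ as
  have hA0 : A' 0 = A.map (PowerSeries.constantCoeff (R := L)) := by
    ext i j
    simp [A']
  have hU' := langCoeff_eq A' U₀ hU₀ (by rw [hA0, hAU]) as has
  refine ⟨Matrix.of fun i j => PowerSeries.mk fun n => U' n i j, ?_, ?_⟩
  · rw [isUnit_det_iff_constantCoeff]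
    convert! hU₀
    ext i j
    simp [U', langCoeff]
  · ext i j n
    have h := congrFun (congrFun (hU' n) i) j
    rw [Matrix.sum_apply] at h
    rw [Matrix.of_apply, PowerSeries.coeff_mk]
    refine Eq.trans ?_ h
    simp only [Matrix.mul_apply, map_sum, PowerSeries.coeff_mul]
    rw [Finset.sum_comm]
    conv_rhs => rw [← Finset.sum_range_reflect]
    rw [Finset.Nat.sum_antidiagonal_eq_sum_range_succ_mk]
    refine Finset.sum_congr rfl fun k hk => Finset.sum_congr rfl fun l _ => ?_
    have hk' : n + 1 - 1 - k = n - k := by omega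
    have hk'' : n - (n - k) = k := by have := Finset.mem_range.1 hk; omega
    rw [hk', hk'']
    simp [A', U', sigmaHat]

end LangPowerSeries

/-! ### The Artin-Schreier cokernel of `R`. -/

section ArtinSchreier

variable {𝔽 : Type*} [Field 𝔽] [Fintype 𝔽]

/-- For an algebraic extension `k` of a finite field `𝔽` with `q` elements, the cokernel of
`y ↦ y - y ^ q` on `k` has dimension at most one over `𝔽`. -/
theorem exists_smul_add_smul_eq_sub_pow {k : Type*} [Field k] [Algebra 𝔽 k]
    [Algebra.IsAlgebraic 𝔽 k] (x₁ x₂ : k) :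
    ∃ α β : 𝔽, (α ≠ 0 ∨ β ≠ 0) ∧ ∃ y : k, α • x₁ + β • x₂ = y - y ^ Fintype.card 𝔽 := by
  -- Over this finite extension, kernel and cokernel of `y ↦ y - y^q` have equal dimension, and the
  -- kernel is only `𝔽`.
  let E := IntermediateField.adjoin 𝔽 ({x₁, x₂} : Set k)
  have hfin : FiniteDimensional 𝔽 E := IntermediateField.finiteDimensional_adjoin fun x _ =>
    (Algebra.IsAlgebraic.isAlgebraic (R := 𝔽) x).isIntegral
  let e₁ : E := ⟨x₁, IntermediateField.subset_adjoin 𝔽 _ (by simp)⟩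
  let e₂ : E := ⟨x₂, IntermediateField.subset_adjoin 𝔽 _ (by simp)⟩
  let f : E →ₗ[𝔽] E := LinearMap.id - (FiniteField.frobeniusAlgHom 𝔽 E).toLinearMap
  have hf : ∀ y, f y = y - y ^ Fintype.card 𝔽 := fun y => rfl
  have hker : Module.finrank 𝔽 (LinearMap.ker f) ≤ 1 := by
    refine (Submodule.finrank_mono (t := Submodule.span 𝔽 {(1 : E)}) fun y hy => ?_).trans
      ((finrank_span_le_card _).trans (by simp))
    rw [LinearMap.mem_ker, hf, sub_eq_zero] at hy
    obtain ⟨a, rfl⟩ := mem_range_algebraMap_of_pow_card 𝔽 hy.symm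
    rw [Algebra.algebraMap_eq_smul_one]
    exact Submodule.smul_mem _ _ (Submodule.mem_span_singleton_self _)
  let g : (𝔽 × 𝔽) →ₗ[𝔽] (E ⧸ LinearMap.range f) :=
    (LinearMap.range f).mkQ ∘ₗ
      ((LinearMap.toSpanSingleton 𝔽 E e₁).coprod (LinearMap.toSpanSingleton 𝔽 E e₂))
  have hg : ¬ Function.Injective g := fun hinj => by
    have h1 := LinearMap.finrank_le_finrank_of_injective hinj
    have h2 := LinearMap.finrank_range_add_finrank_ker f
    have h3 := Submodule.finrank_quotient_add_finrank (LinearMap.range f)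
    rw [Module.finrank_prod, Module.finrank_self] at h1
    omega
  rw [injective_iff_map_eq_zero] at hg
  push Not at hg
  obtain ⟨⟨α, β⟩, h0, hne⟩ := hg
  obtain ⟨y, hy⟩ := (Submodule.Quotient.mk_eq_zero _).1 h0
  refine ⟨α, β, ?_, y, ?_⟩
  · by_contra! h
    exact hne (Prod.ext h.1 h.2)
  · have := congrArg (algebraMap E k) hy
    rw [hf] at this
    simpa [e₁, e₂] using this.symm

/-- The polynomial `X^q - X + b` has derivative `-1`, so by Hensel's lemma each of its roots in the
residue field lifts to `R`; the relation found over the residue field therefore holds over `R`. -/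
theorem exists_smul_add_smul_eq_sub_pow_of_isAdicComplete {R : Type*} [CommRing R] [IsLocalRing R]
    [IsAdicComplete (IsLocalRing.maximalIdeal R) R] [Algebra 𝔽 R]
    [Algebra.IsAlgebraic 𝔽 (IsLocalRing.ResidueField R)] (x₁ x₂ : R) :
    ∃ α β : 𝔽, (α ≠ 0 ∨ β ≠ 0) ∧ ∃ y : R, α • x₁ + β • x₂ = y - y ^ Fintype.card 𝔽 := by
  obtain ⟨α, β, hne, y, hy⟩ := exists_smul_add_smul_eq_sub_pow (𝔽 := 𝔽)
    (IsLocalRing.residue R x₁) (IsLocalRing.residue R x₂)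
  obtain ⟨y, rfl⟩ := IsLocalRing.residue_surjective y
  refine ⟨α, β, hne, ?_⟩
  set b := α • x₁ + β • x₂ with hb
  have hmem : y ^ Fintype.card 𝔽 - (y - b) ∈ IsLocalRing.maximalIdeal R := by
    rw [← Ideal.Quotient.eq_zero_iff_mem]
    have h1 : IsLocalRing.residue R b =
        α • IsLocalRing.residue R x₁ + β • IsLocalRing.residue R x₂ := by
      rw [hb, map_add]
      rfl
    change IsLocalRing.residue R (y ^ Fintype.card 𝔽 - (y - b)) = 0
    rw [map_sub, map_sub, map_pow, h1, hy]
    ring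
  have hdeg : (Polynomial.X - Polynomial.C b).degree < (Fintype.card 𝔽 : WithBot ℕ) := by
    rw [Polynomial.degree_X_sub_C]
    exact_mod_cast Fintype.one_lt_card (α := 𝔽)
  obtain ⟨a, ha, -⟩ := HenselianRing.is_henselian (I := IsLocalRing.maximalIdeal R)
    (Polynomial.X ^ Fintype.card 𝔽 - (Polynomial.X - Polynomial.C b))
    (Polynomial.monic_X_pow_sub hdeg) y (by simpa using hmem)
    (by simp [Polynomial.derivative_X_pow, natCast_card_eq_zero])
  refine ⟨a, ?_⟩
  simp only [Polynomial.IsRoot, Polynomial.eval_sub, Polynomial.eval_pow, Polynomial.eval_X,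
    Polynomial.eval_C] at ha
  linear_combination ha

end ArtinSchreier

/-! ### Fixed vectors of Frobenius-semilinear maps over `L⟦z⟧`. -/

section FixedVectors

variable {𝔽 : Type*} [Field 𝔽] [Fintype 𝔽] {L : Type*} [Field L] [Algebra 𝔽 L]
  {N : Type*} [AddCommGroup N] [Module L⟦X⟧ N] {r : ℕ}

theorem map_sum_smul_basis (φ : N →ₛₗ[sigmaHat 𝔽 L] N) (e : Module.Basis (Fin r) L⟦X⟧ N)
    (A : Matrix (Fin r) (Fin r) L⟦X⟧) (hA : ∀ j, φ (e j) = ∑ i, A i j • e i)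
    (V : Matrix (Fin r) (Fin r) L⟦X⟧) (j : Fin r) :
    φ (∑ i, V i j • e i) = ∑ i, (A * V.map (sigmaHat 𝔽 L)) i j • e i := by
  simp only [map_sum, LinearMap.map_smulₛₗ, hA, Finset.smul_sum, smul_smul, Matrix.mul_apply,
    Finset.sum_smul, Matrix.map_apply]
  rw [Finset.sum_comm]
  exact Finset.sum_congr rfl fun i _ => Finset.sum_congr rfl fun k _ => by rw [mul_comm]

theorem mul_map_sigmaHat_eq_of_fixed (φ : N →ₛₗ[sigmaHat 𝔽 L] N)
    (e : Module.Basis (Fin r) L⟦X⟧ N)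
    (A : Matrix (Fin r) (Fin r) L⟦X⟧) (hA : ∀ j, φ (e j) = ∑ i, A i j • e i)
    (x : Fin r → N) (hx : ∀ j, φ (x j) = x j) :
    A * (e.toMatrix x).map (sigmaHat 𝔽 L) = e.toMatrix x := by
  ext1 i j
  have h := map_sum_smul_basis φ e A hA (e.toMatrix x) j
  rw [e.sum_toMatrix_smul_self, hx] at h
  have h1 := congrArg (fun y => e.repr y i) h
  simp only [e.repr_sum_self] at h1
  rw [e.toMatrix_apply, h1]

/-- A Frobenius-semilinear endomorphism of a free `L⟦z⟧`-module with invertible matrix has a basis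
of fixed vectors if `L` is separably closed. -/
theorem exists_basis_fixed [IsSepClosed L] (φ : N →ₛₗ[sigmaHat 𝔽 L] N)
    (e : Module.Basis (Fin r) L⟦X⟧ N)
    (A : Matrix (Fin r) (Fin r) L⟦X⟧) (hA : ∀ j, φ (e j) = ∑ i, A i j • e i)
    (hdet : IsUnit A.det) :
    ∃ B : Module.Basis (Fin r) L⟦X⟧ N, ∀ j, φ (B j) = B j := by
  obtain ⟨U, hU, hAU⟩ := exists_isUnit_mul_map_sigmaHat_eq (𝔽 := 𝔽) A hdet
  refine ⟨e.map (Matrix.toLinearEquiv e U hU), fun j => ?_⟩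
  have h : e.map (Matrix.toLinearEquiv e U hU) j = ∑ i, U i j • e i := by
    rw [Module.Basis.map_apply]
    exact Matrix.toLin_self e e U j
  rw [h, map_sum_smul_basis φ e A hA, hAU]

end FixedVectors

theorem mem_range_toSep_of_sigmaHat_eq {𝔽 L : Type*} [Field 𝔽] [Fintype 𝔽] [Field L] [Algebra 𝔽 L]
    {y : L⟦X⟧} (hy : sigmaHat 𝔽 L y = y) : ∃ a : 𝔽⟦X⟧, LocalShtuka.toSep 𝔽 L a = y := by
  have h : ∀ n, ∃ a : 𝔽, algebraMap 𝔽 L a = PowerSeries.coeff n y := fun n =>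
    mem_range_algebraMap_of_pow_card 𝔽 (by
      conv_rhs => rw [← hy]
      simp [sigmaHat])
  choose a ha using h
  exact ⟨PowerSeries.mk a, by ext n; simp [ha]⟩

theorem toSep_injective (𝔽 L : Type*) [Field 𝔽] [Field L] [Algebra 𝔽 L] :
    Function.Injective (LocalShtuka.toSep 𝔽 L) :=
  PowerSeries.map_injective _ (algebraMap 𝔽 L).injective

/-! ### The Tate module and its Galois action in matrix form. -/

namespace LocalShtuka

variable {𝔽 : Type*} [Field 𝔽] [Fintype 𝔽] {R : Type*} [CommRing R] [Algebra 𝔽 R] {ζ : R}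
  {Ks : Type*} [Field Ks] [Algebra R Ks] (M : LocalShtuka 𝔽 ζ)

variable (Ks) in
/-- The basis of `M ⊗ K^sep⟦z⟧` induced by a basis of `M`. -/
def sepBasis {ι : Type*} (b : Module.Basis ι R⟦X⟧ M.carrier) :
    Module.Basis ι Ks⟦X⟧ (SepFibre Ks M) :=
  letI := (toSep R Ks).toAlgebra
  (Algebra.TensorProduct.basis Ks⟦X⟧ b : Module.Basis ι Ks⟦X⟧ (Ks⟦X⟧ ⊗[R⟦X⟧] M.carrier))

theorem sepBasis_apply {ι : Type*} (b : Module.Basis ι R⟦X⟧ M.carrier) (i : ι) :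
    M.sepBasis Ks b i = toSepFibre Ks M (b i) :=
  letI := (toSep R Ks).toAlgebra
  Algebra.TensorProduct.basis_apply (A := Ks⟦X⟧) b i

theorem locToSepFibre_of (hζ : algebraMap R Ks ζ ≠ 0) (m : M.carrier) :
    locToSepFibre M hζ (BaseChange.of (toLoc ζ) _ m) = toSepFibre Ks M m :=
  BaseChange.lift_of _ _ m

variable [Algebra 𝔽 Ks]

theorem frob_sepBasis (hζ : algebraMap R Ks ζ ≠ 0) {r : ℕ}
    (b : Module.Basis (Fin r) R⟦X⟧ M.carrier) (T : Matrix (Fin r) (Fin r) (Loc ζ))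
    (hT : ∀ j, M.tauMap (b j) = ∑ i, T i j • BaseChange.of (toLoc ζ) _ (b i)) (j : Fin r) :
    M.frob hζ (M.sepBasis Ks b j) = ∑ i, T.map (locToSep hζ) i j • M.sepBasis Ks b i := by
  rw [sepBasis_apply, frob_toSepFibre, hT, map_sum]
  refine Finset.sum_congr rfl fun i _ => ?_
  rw [LinearMap.map_smulₛₗ, locToSepFibre_of, sepBasis_apply, Matrix.map_apply]

theorem mem_tateModule {hζ : algebraMap R Ks ζ ≠ 0} {x : SepFibre Ks M} :
    x ∈ M.tateModule hζ ↔ M.frob hζ x = x := Iff.rfl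

/-- A `K^sep⟦z⟧`-basis of `M ⊗ K^sep⟦z⟧` fixed by Frobenius is an `𝔽⟦z⟧`-basis of the Tate
module. -/
def tateBasis (hζ : algebraMap R Ks ζ ≠ 0) {r : ℕ}
    (B : Module.Basis (Fin r) Ks⟦X⟧ (SepFibre Ks M)) (hB : ∀ j, M.frob hζ (B j) = B j) :
    Module.Basis (Fin r) 𝔽⟦X⟧ (M.tateModule hζ) :=
  Module.Basis.mk (v := fun j => (⟨B j, hB j⟩ : M.tateModule hζ))
    (by
      rw [Fintype.linearIndependent_iff]
      intro a ha i
      have h := congrArg (fun x : M.tateModule hζ => (x : SepFibre Ks M)) ha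
      simp only [Submodule.coe_sum, Submodule.coe_smul, Submodule.coe_zero, smul_def] at h
      have h1 := Fintype.linearIndependent_iff.1 B.linearIndependent _ h i
      exact toSep_injective 𝔽 Ks (h1.trans (map_zero _).symm))
    (by
      rintro ⟨x, hx⟩ -
      rw [mem_tateModule] at hx
      -- Since `x` and all the `B j` are fixed, uniqueness of coordinates makes them `σ̂`-invariant,
      -- so they lie in `𝔽⟦z⟧`.
      have h1 : ∀ j, sigmaHat 𝔽 Ks (B.repr x j) = B.repr x j := fun j => by
        conv_lhs at hx => rw [← B.sum_repr x]
        simp only [map_sum, LinearMap.map_smulₛₗ, hB] at hx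
        conv_rhs => rw [← hx]
        rw [B.repr_sum_self]
      choose a ha using fun j => mem_range_toSep_of_sigmaHat_eq (h1 j)
      have h2 : (⟨x, hx⟩ : M.tateModule hζ) = ∑ j, a j • ⟨B j, hB j⟩ := Subtype.ext (by
        simp only [Submodule.coe_sum, Submodule.coe_smul, smul_def, ha]
        exact (B.sum_repr x).symm)
      rw [h2]
      exact Submodule.sum_mem _ fun j _ => Submodule.smul_mem _ _ (Submodule.subset_span ⟨j, rfl⟩))

/-- The matrix of a basis of the Tate module with respect to a basis of `M ⊗ K^sep⟦z⟧` is
invertible. -/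
theorem isUnit_det_toMatrix_tate [IsSepClosed Ks] (hζ : algebraMap R Ks ζ ≠ 0) {r : ℕ}
    (e : Module.Basis (Fin r) Ks⟦X⟧ (SepFibre Ks M))
    (A : Matrix (Fin r) (Fin r) Ks⟦X⟧) (hA : ∀ j, M.frob hζ (e j) = ∑ i, A i j • e i)
    (hdet : IsUnit A.det) (b : Module.Basis (Fin r) 𝔽⟦X⟧ (M.tateModule hζ)) :
    IsUnit (e.toMatrix fun j => (b j : SepFibre Ks M)).det := by
  obtain ⟨B, hB⟩ := exists_basis_fixed (M.frob hζ) e A hA hdet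
  -- The fixed basis `B` lies in the Tate module, so its invertible matrix factors through that of
  -- `b`; the left factor must then have unit determinant.
  let P : Matrix (Fin r) (Fin r) Ks⟦X⟧ :=
    Matrix.of fun k j => toSep 𝔽 Ks (b.repr ⟨B j, hB j⟩ k)
  have hP : (e.toMatrix fun j => (b j : SepFibre Ks M)) * P = e.toMatrix B := by
    ext1 i j
    have h := congrArg (fun x : M.tateModule hζ => e.repr (x : SepFibre Ks M) i)
      (b.sum_repr ⟨B j, hB j⟩)
    simp only [Submodule.coe_sum, Submodule.coe_smul, smul_def, map_sum, map_smul,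
      Finsupp.coe_finsetSum, Finset.sum_apply, Finsupp.smul_apply, smul_eq_mul] at h
    rw [e.toMatrix_apply, ← h, Matrix.mul_apply]
    exact Finset.sum_congr rfl fun k _ => mul_comm _ _
  have hu : IsUnit (e.toMatrix B).det :=
    Matrix.isUnit_det_of_right_inverse (e.toMatrix_mul_toMatrix_flip B)
  rw [← hP, Matrix.det_mul] at hu
  exact isUnit_of_mul_isUnit_left hu

variable {K : Type*} [Field K] [Algebra R K] [Algebra K Ks] [IsScalarTower R K Ks]
  [IsScalarTower 𝔽 R Ks]

/-- Galois fixes the basis coming from `M`, so it acts on coordinates through coefficients alone;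
expanding `g(b j)` in the Tate basis gives the right-hand side. The determinant of this identity
identifies `det ρ(g)` with `g(u)/u`. -/
theorem map_galPS_toMatrix_tate (hζ : algebraMap R Ks ζ ≠ 0) {r : ℕ}
    (b₀ : Module.Basis (Fin r) R⟦X⟧ M.carrier)
    (b : Module.Basis (Fin r) 𝔽⟦X⟧ (M.tateModule hζ)) (g : Ks ≃ₐ[K] Ks) :
    ((M.sepBasis Ks b₀).toMatrix fun j => (b j : SepFibre Ks M)).map (galPS g) =
      ((M.sepBasis Ks b₀).toMatrix fun j => (b j : SepFibre Ks M)) *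
        (M.galoisRepGL (K := K) hζ b g : Matrix (Fin r) (Fin r) 𝔽⟦X⟧).map (toSep 𝔽 Ks) := by
  set e := M.sepBasis Ks b₀ with he
  have hge : ∀ i, M.galFibre g (e i) = e i := fun i => by
    rw [he, sepBasis_apply, galFibre_toSepFibre]
  ext1 i j
  have h1 : M.galFibre g (b j : SepFibre Ks M) = ∑ k, galPS g (e.repr (b j) k) • e k := by
    conv_lhs => rw [← e.sum_repr (b j : SepFibre Ks M)]
    simp only [map_sum, LinearMap.map_smulₛₗ, hge]
  have h2 : M.galFibre g (b j : SepFibre Ks M) =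
      ∑ k, toSep 𝔽 Ks (b.repr (M.galoisRep (K := K) hζ g (b j)) k) • (b k : SepFibre Ks M) := by
    have h := congrArg (fun x : M.tateModule hζ => (x : SepFibre Ks M))
      (b.sum_repr (M.galoisRep (K := K) hζ g (b j)))
    simp only [Submodule.coe_sum, Submodule.coe_smul, smul_def] at h
    exact h.symm
  have h3 := congrArg (fun x => e.repr x i) (h1.symm.trans h2)
  beta_reduce at h3
  rw [e.repr_sum_self] at h3
  simp only [map_sum, map_smul,
      Finsupp.coe_finsetSum, Finset.sum_apply, Finsupp.smul_apply, smul_eq_mul] at h3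
  rw [Matrix.map_apply, e.toMatrix_apply, h3, Matrix.mul_apply]
  refine Finset.sum_congr rfl fun k _ => ?_
  have hk : (M.galoisRepGL (K := K) hζ b g : Matrix (Fin r) (Fin r) 𝔽⟦X⟧) k j =
      b.repr (M.galoisRep (K := K) hζ g (b j)) k := LinearMap.toMatrixAlgEquiv_apply b _ k j
  rw [mul_comm, Matrix.map_apply, hk, e.toMatrix_apply]

end LocalShtuka

/-! ### Logarithmic derivatives of units of `A⟦z⟧`. -/

section LogDerivative

open PowerSeries

variable {A B : Type*} [CommRing A] [CommRing B]

/-- The logarithmic derivative `u' / u` of an invertible power series. -/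
def logDerivative (u : A⟦X⟧ˣ) : A⟦X⟧ := derivative A (u : A⟦X⟧) * ((u⁻¹ : A⟦X⟧ˣ) : A⟦X⟧)

theorem logDerivative_mul (u v : A⟦X⟧ˣ) :
    logDerivative (u * v) = logDerivative u + logDerivative v := by
  simp only [logDerivative, Units.val_mul, mul_inv, Derivation.leibniz, smul_eq_mul]
  linear_combination (derivative A (v : A⟦X⟧) * ((v⁻¹ : A⟦X⟧ˣ) : A⟦X⟧)) * u.mul_inv +
    (derivative A (u : A⟦X⟧) * ((u⁻¹ : A⟦X⟧ˣ) : A⟦X⟧)) * v.mul_inv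

/-- This is where `p ∣ d` takes effect: the factor `(z - ζ)^d` of `det τ` is a `p`-th power and
drops out. -/
theorem logDerivative_pow_char (p : ℕ) [CharP A p] (u : A⟦X⟧ˣ) : logDerivative (u ^ p) = 0 := by
  have h : ((p : ℕ) : A⟦X⟧) = 0 := by
    rw [← map_natCast (PowerSeries.C (R := A)), CharP.cast_eq_zero, map_zero]
  rw [logDerivative, Units.val_pow_eq_pow_val, derivative_pow, h]
  simp

theorem derivative_map (f : A →+* B) (x : A⟦X⟧) :
    derivative B (PowerSeries.map f x) = PowerSeries.map f (derivative A x) := by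
  ext n
  simp [coeff_derivative]

theorem logDerivative_map (f : A →+* B) (u : A⟦X⟧ˣ) (v : B⟦X⟧ˣ)
    (h : (v : B⟦X⟧) = PowerSeries.map f u) :
    logDerivative v = PowerSeries.map f (logDerivative u) := by
  have hinv : ((v⁻¹ : B⟦X⟧ˣ) : B⟦X⟧) = PowerSeries.map f ((u⁻¹ : A⟦X⟧ˣ) : A⟦X⟧) := by
    rw [Units.inv_eq_of_mul_eq_one_right]
    rw [h, ← map_mul, u.mul_inv, map_one]
  rw [logDerivative, hinv, h, derivative_map, ← map_mul, logDerivative]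

/-- The unit `1 + z ^ (n + 1)` of `A⟦z⟧`. -/
def oneAddXPow (A : Type*) [CommRing A] (n : ℕ) : A⟦X⟧ˣ :=
  (isUnit_iff_constantCoeff.2 (by simp) : IsUnit (1 + X ^ (n + 1) : A⟦X⟧)).unit

theorem val_oneAddXPow (n : ℕ) : (oneAddXPow A n : A⟦X⟧) = 1 + X ^ (n + 1) := rfl

theorem val_inv_oneAddXPow (n : ℕ) : (((oneAddXPow A n)⁻¹ : A⟦X⟧ˣ) : A⟦X⟧) =
    1 - X ^ (n + 1) * (((oneAddXPow A n)⁻¹ : A⟦X⟧ˣ) : A⟦X⟧) := by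
  have h := (oneAddXPow A n).mul_inv
  rw [val_oneAddXPow] at h
  linear_combination h

/-- The factor `n + 1` produced by differentiation is `1` when `p ∣ n`, so these units have
logarithmic derivatives with leading term exactly `zⁿ`. -/
theorem logDerivative_oneAddXPow (p n : ℕ) [CharP A p] (hn : p ∣ n) :
    logDerivative (oneAddXPow A n) = X ^ n * (((oneAddXPow A n)⁻¹ : A⟦X⟧ˣ) : A⟦X⟧) := by
  have h : ((n : ℕ) : A⟦X⟧) = 0 := by
    rw [← map_natCast (PowerSeries.C (R := A)), (CharP.cast_eq_zero_iff A p n).2 hn, map_zero]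
  rw [logDerivative, val_oneAddXPow, map_add, derivative_one, zero_add, derivative_pow]
  simp [h]

theorem coeff_logDerivative_oneAddXPow (p n : ℕ) [CharP A p] (hn : p ∣ n) :
    coeff n (logDerivative (oneAddXPow A n)) = 1 := by
  rw [logDerivative_oneAddXPow p n hn, coeff_X_pow_mul', if_pos le_rfl, Nat.sub_self,
    val_inv_oneAddXPow, map_sub, coeff_X_pow_mul', if_neg (by omega)]
  simp

theorem coeff_logDerivative_oneAddXPow_of_lt (p n i : ℕ) [CharP A p] (hn : p ∣ n) (hi : i < n) :
    coeff i (logDerivative (oneAddXPow A n)) = 0 := by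
  rw [logDerivative_oneAddXPow p n hn, coeff_X_pow_mul', if_neg (by omega)]

end LogDerivative

/-! ### The linear relation satisfied by the determinant character. -/

section Character

/-- If `u` solves `wᵖ c σ̂(u) = u` with `c` a unit of `R⟦z⟧`, then any two coefficients of the
logarithmic derivative of the character `g ↦ g(u) / u` are linearly dependent over `𝔽`. -/
theorem exists_linear_relation_coeff_logDerivative {p : ℕ} {𝔽 : Type*} [Field 𝔽] [Fintype 𝔽]
    {R : Type*} [CommRing R] [IsLocalRing R]
    [IsAdicComplete (IsLocalRing.maximalIdeal R) R]
    [Algebra 𝔽 R] [Algebra.IsAlgebraic 𝔽 (IsLocalRing.ResidueField R)]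
    {K : Type*} [Field K] [Algebra R K] {Ks : Type*} [Field Ks] [CharP Ks p] [Algebra K Ks]
    [Algebra R Ks] [IsScalarTower R K Ks] [Algebra 𝔽 Ks] [IsScalarTower 𝔽 R Ks]
    (u w : Ks⟦X⟧ˣ) (c : R⟦X⟧ˣ)
    (hu : (w : Ks⟦X⟧) ^ p * LocalShtuka.toSep R Ks c * sigmaHat 𝔽 Ks u = u) (i j : ℕ) :
    ∃ α β : 𝔽, (α ≠ 0 ∨ β ≠ 0) ∧ ∀ (g : Ks ≃ₐ[K] Ks) (χ : 𝔽⟦X⟧ˣ),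
      LocalShtuka.galPS g u = u * LocalShtuka.toSep 𝔽 Ks χ →
      α * PowerSeries.coeff i (logDerivative χ) + β * PowerSeries.coeff j (logDerivative χ) = 0 := by
  -- The relation is chosen from `c` alone, before `g`, so one pair `(α, β)` serves the whole Galois
  -- group.
  obtain ⟨α, β, hne, y, hy⟩ := exists_smul_add_smul_eq_sub_pow_of_isAdicComplete (𝔽 := 𝔽)
    (PowerSeries.coeff i (logDerivative c)) (PowerSeries.coeff j (logDerivative c))
  refine ⟨α, β, hne, fun g χ hχ => ?_⟩
  have hψ : LocalShtuka.toSep R Ks (logDerivative c) + sigmaHat 𝔽 Ks (logDerivative u) =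
      logDerivative u := by
    obtain ⟨c', hc'⟩ := c.isUnit.map (LocalShtuka.toSep R Ks)
    obtain ⟨u', hu'⟩ := u.isUnit.map (sigmaHat 𝔽 Ks)
    have h : w ^ p * c' * u' = u := Units.ext (by
      rw [Units.val_mul, Units.val_mul, Units.val_pow_eq_pow_val, hc', hu', hu])
    have h1 := congrArg logDerivative h
    rw [logDerivative_mul, logDerivative_mul, logDerivative_pow_char, zero_add,
      logDerivative_map _ c c' hc', logDerivative_map _ u u' hu'] at h1
    exact h1
  have hg : LocalShtuka.galPS g (logDerivative u) =
      logDerivative u + LocalShtuka.toSep 𝔽 Ks (logDerivative χ) := by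
    obtain ⟨u', hu'⟩ := u.isUnit.map (LocalShtuka.galPS g)
    obtain ⟨χ', hχ'⟩ := χ.isUnit.map (LocalShtuka.toSep 𝔽 Ks)
    have h : u' = u * χ' := Units.ext (by rw [Units.val_mul, hu', hχ', hχ])
    have h1 := congrArg logDerivative h
    rw [logDerivative_mul, logDerivative_map _ u u' hu', logDerivative_map _ χ χ' hχ'] at h1
    exact h1
  have hψn : ∀ n, algebraMap R Ks (PowerSeries.coeff n (logDerivative c)) =
      PowerSeries.coeff n (logDerivative u) -
        PowerSeries.coeff n (logDerivative u) ^ Fintype.card 𝔽 := fun n => by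
    have h := congrArg (PowerSeries.coeff n) hψ
    rw [map_add] at h
    simp only [sigmaHat, PowerSeries.coeff_map] at h
    exact eq_sub_of_add_eq h
  have hgn : ∀ n, g (PowerSeries.coeff n (logDerivative u)) =
      PowerSeries.coeff n (logDerivative u) +
        algebraMap 𝔽 Ks (PowerSeries.coeff n (logDerivative χ)) := fun n => by
    have h := congrArg (PowerSeries.coeff n) hg
    rw [map_add] at h
    simp only [LocalShtuka.galPS, PowerSeries.coeff_map] at h
    exact h
  have hgR : ∀ x : R, g (algebraMap R Ks x) = algebraMap R Ks x := fun x => by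
    rw [IsScalarTower.algebraMap_apply R K Ks, g.commutes]
  have hgF : ∀ x : 𝔽, g (algebraMap 𝔽 Ks x) = algebraMap 𝔽 Ks x := fun x => by
    rw [IsScalarTower.algebraMap_apply 𝔽 R Ks, hgR]
  set ψi := PowerSeries.coeff i (logDerivative u)
  set ψj := PowerSeries.coeff j (logDerivative u)
  -- Both `α ψᵢ + β ψⱼ` and `y` solve the same Artin-Schreier equation, so `s` lies in `𝔽` and is
  -- fixed by `g`; comparing `g(s)` with `s` leaves the claimed relation.
  set s := algebraMap 𝔽 Ks α * ψi + algebraMap 𝔽 Ks β * ψj - algebraMap R Ks y with hs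
  have hspow : s ^ Fintype.card 𝔽 = s := by
    have h := congrArg (algebraMap R Ks) hy
    rw [map_add, map_sub, map_pow, Algebra.smul_def, Algebra.smul_def, map_mul, map_mul,
      ← IsScalarTower.algebraMap_apply, ← IsScalarTower.algebraMap_apply, hψn, hψn] at h
    have h2 : s ^ Fintype.card 𝔽 = algebraMap 𝔽 Ks α * ψi ^ Fintype.card 𝔽 +
        algebraMap 𝔽 Ks β * ψj ^ Fintype.card 𝔽 - algebraMap R Ks y ^ Fintype.card 𝔽 := by
      rw [← frobHom_apply 𝔽 s, hs]
      simp only [map_sub, map_add, map_mul, frobHom_apply, ← map_pow, FiniteField.pow_card]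
    rw [h2, hs]
    linear_combination -h
  obtain ⟨a, ha⟩ := mem_range_algebraMap_of_pow_card 𝔽 hspow
  have hgs : g s = s := by rw [← ha, hgF]
  have h := hgs
  rw [hs] at h
  simp only [map_sub, map_add, map_mul, hgF, hgR] at h
  rw [hgn, hgn] at h
  refine (algebraMap 𝔽 Ks).injective ?_
  rw [map_add, map_mul, map_mul, map_zero]
  linear_combination h

end Character

/-! ### Elements of open subsets near the identity. -/

section Topology

/-- The block matrix `diag(1, …, a, …, 1)` with `a` at the `i`-th place. -/
def diagHom (A : Type*) [CommRing A] {r : ℕ} (i : Fin r) : A →* Matrix (Fin r) (Fin r) A :=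
  (Matrix.diagonalRingHom (Fin r) A : (Fin r → A) →* _).comp (MonoidHom.mulSingle (fun _ => A) i)

theorem det_diagHom {A : Type*} [CommRing A] {r : ℕ} (i : Fin r) (a : A) :
    (diagHom A i a).det = a := by
  change (Matrix.diagonal (Pi.mulSingle i a)).det = a
  rw [Matrix.det_diagonal, Fintype.prod_pi_mulSingle']

theorem eventually_diagHom_oneAddXPow_mem (𝔽 : Type*) [Field 𝔽] {r : ℕ} (i : Fin r)
    (S : Set (GL (Fin r) 𝔽⟦X⟧)) (hS : IsOpen[zAdicTopologyGL 𝔽 r] S) (h1 : 1 ∈ S) :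
    ∀ᶠ n in Filter.atTop, Units.map (diagHom 𝔽⟦X⟧ i) (oneAddXPow 𝔽 n) ∈ S := by
  let : TopologicalSpace 𝔽 := ⊥
  let : TopologicalSpace 𝔽⟦X⟧ := PowerSeries.WithPiTopology.instTopologicalSpace 𝔽
  have hcont : Continuous (diagHom 𝔽⟦X⟧ i) := by
    change Continuous fun a => Matrix.diagonal (Pi.mulSingle i a)
    exact (continuous_mulSingle i).matrix_diagonal
  have hlim : Filter.Tendsto (oneAddXPow 𝔽) Filter.atTop (𝓝 1) := by
    -- Convergence in the unit group requires convergence of the inverses too; both series agree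
    -- with `1` through degree `n`.
    rw [Units.isInducing_embedProduct.tendsto_nhds_iff, Prod.tendsto_iff]
    constructor
    · change Filter.Tendsto (fun n => (oneAddXPow 𝔽 n : 𝔽⟦X⟧)) Filter.atTop (𝓝 1)
      rw [PowerSeries.WithPiTopology.tendsto_iff_coeff_tendsto]
      intro k
      refine tendsto_const_nhds.congr' ?_
      filter_upwards [Filter.eventually_ge_atTop k] with n hn
      rw [val_oneAddXPow, map_add, PowerSeries.coeff_X_pow, if_neg (by omega), add_zero]
    · refine (MulOpposite.continuous_op.tendsto _).comp
        (f := fun n => (((oneAddXPow 𝔽 n)⁻¹ : 𝔽⟦X⟧ˣ) : 𝔽⟦X⟧)) (y := 𝓝 1) ?_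
      rw [PowerSeries.WithPiTopology.tendsto_iff_coeff_tendsto]
      intro k
      refine tendsto_const_nhds.congr' ?_
      filter_upwards [Filter.eventually_ge_atTop k] with n hn
      rw [val_inv_oneAddXPow, map_sub, PowerSeries.coeff_X_pow_mul', if_neg (by omega), sub_zero]
  have h2 := ((Continuous.units_map (diagHom 𝔽⟦X⟧ i) hcont).tendsto 1).comp hlim
  rw [map_one] at h2
  exact h2.eventually (hS.mem_nhds h1)

end Topology

/-! ### Non-openness of the image. -/

theorem map_det_eq_of_map_eq_mul {A B : Type*} [CommRing A] [CommRing B] {r : ℕ} (f : B →+* B)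
    (g : A →+* B) {V : Matrix (Fin r) (Fin r) B} {P : Matrix (Fin r) (Fin r) A}
    (h : V.map f = V * P.map g) : f V.det = V.det * g P.det := by
  have h1 := congrArg Matrix.det h
  rw [Matrix.det_mul] at h1
  rw [f.map_det, g.map_det]
  exact h1

theorem LocalShtuka.not_isOpen_range_galoisRepGL
    {p : ℕ} {𝔽 : Type*} [Field 𝔽] [Fintype 𝔽] [CharP 𝔽 p]
    {R : Type*} [CommRing R] [IsLocalRing R]
    [IsAdicComplete (IsLocalRing.maximalIdeal R) R]
    [Algebra 𝔽 R] [Algebra.IsAlgebraic 𝔽 (IsLocalRing.ResidueField R)]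
    {K : Type*} [Field K] [Algebra R K]
    {Ks : Type*} [Field Ks] [Algebra K Ks] [IsSepClosed Ks]
    [Algebra R Ks] [IsScalarTower R K Ks] [Algebra 𝔽 Ks] [IsScalarTower 𝔽 R Ks]
    {ζ : R} (hζ : algebraMap R Ks ζ ≠ 0)
    (M : LocalShtuka 𝔽 ζ) {r : ℕ} (hr : 1 ≤ r) (b₀ : Module.Basis (Fin r) R⟦X⟧ M.carrier)
    (A : Matrix (Fin r) (Fin r) Ks⟦X⟧)
    (hA : ∀ j, M.frob hζ (M.sepBasis Ks b₀ j) = ∑ i, A i j • M.sepBasis Ks b₀ i)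
    (w : Ks⟦X⟧ˣ) (c : R⟦X⟧ˣ) (hdetA : A.det = (w : Ks⟦X⟧) ^ p * LocalShtuka.toSep R Ks c)
    (b : Module.Basis (Fin r) 𝔽⟦X⟧ (M.tateModule hζ)) :
    ¬ IsOpen[zAdicTopologyGL 𝔽 r] (Set.range (M.galoisRepGL (K := K) hζ b)) := by
  intro hopen
  have : CharP Ks p := charP_of_injective_algebraMap (algebraMap 𝔽 Ks).injective p
  have hunit : IsUnit A.det := by
    rw [hdetA]
    exact (w.isUnit.pow p).mul (c.isUnit.map (LocalShtuka.toSep R Ks))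
  set V := (M.sepBasis Ks b₀).toMatrix fun j => (b j : LocalShtuka.SepFibre Ks M) with hV
  have hVdet : IsUnit V.det := M.isUnit_det_toMatrix_tate hζ _ _ hA hunit b
  have hVfix := mul_map_sigmaHat_eq_of_fixed (M.frob hζ) _ _ hA _ fun j => (b j).2
  obtain ⟨u, hu⟩ := hVdet
  have huw : (w : Ks⟦X⟧) ^ p * LocalShtuka.toSep R Ks c * sigmaHat 𝔽 Ks u = u := by
    have h := congrArg Matrix.det hVfix
    rw [Matrix.det_mul, hdetA, ← RingHom.mapMatrix_apply, ← RingHom.map_det, ← hV, ← hu] at h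
    exact h
  have hgal : ∀ g : Ks ≃ₐ[K] Ks, LocalShtuka.galPS g u = u * LocalShtuka.toSep 𝔽 Ks
      (M.galoisRepGL (K := K) hζ b g : Matrix (Fin r) (Fin r) 𝔽⟦X⟧).det := fun g => by
    rw [hu]
    exact map_det_eq_of_map_eq_mul _ _ (M.map_galPS_toMatrix_tate (K := K) hζ b₀ b g)
  obtain ⟨N, hN⟩ := Filter.eventually_atTop.1 (eventually_diagHom_oneAddXPow_mem 𝔽
    (⟨0, hr⟩ : Fin r) _ hopen ⟨1, map_one _⟩)
  have hp : 0 < p := (CharP.char_is_prime 𝔽 p).pos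
  -- Both degrees are multiples of `p` and at least `N`. Testing on `1 + z^(n+1)` with `n = p(N+1)`
  -- kills the lower coefficient and forces `β = 0`; then `n = pN` forces `α = 0`.
  obtain ⟨α, β, hne, hrel⟩ := exists_linear_relation_coeff_logDerivative (K := K) (p := p)
    u w c huw (p * N) (p * (N + 1))
  have hrel' : ∀ n, N ≤ n →
      α * PowerSeries.coeff (p * N) (logDerivative (oneAddXPow 𝔽 n)) +
        β * PowerSeries.coeff (p * (N + 1)) (logDerivative (oneAddXPow 𝔽 n)) = 0 := fun n hn => by
    obtain ⟨g, hg⟩ := hN n hn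
    refine hrel g _ ((hgal g).trans ?_)
    rw [hg]
    change _ * LocalShtuka.toSep 𝔽 Ks (diagHom 𝔽⟦X⟧ _ (oneAddXPow 𝔽 n : 𝔽⟦X⟧)).det = _
    rw [det_diagHom]
  have hle : N ≤ p * N := Nat.le_mul_of_pos_left N hp
  have hlt : p * N < p * (N + 1) := Nat.mul_lt_mul_of_pos_left N.lt_succ_self hp
  have hβ : β = 0 := by
    have h := hrel' (p * (N + 1)) (hle.trans hlt.le)
    rwa [coeff_logDerivative_oneAddXPow_of_lt p _ _ (dvd_mul_right _ _) hlt,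
      coeff_logDerivative_oneAddXPow p _ (dvd_mul_right _ _), mul_zero, zero_add, mul_one] at h
  have hα : α = 0 := by
    have h := hrel' (p * N) hle
    rwa [coeff_logDerivative_oneAddXPow p _ (dvd_mul_right _ _), hβ, zero_mul, add_zero,
      mul_one] at h
  exact hne.elim (fun h => h hα) fun h => h hβ

end

theorem mainTheorem2
    {p : ℕ} {𝔽 : Type*} [Field 𝔽] [Fintype 𝔽] [CharP 𝔽 p]
    {R : Type*} [CommRing R] [IsDomain R] [IsDiscreteValuationRing R]
    [IsAdicComplete (IsLocalRing.maximalIdeal R) R]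
    [Algebra 𝔽 R] [Algebra.IsAlgebraic 𝔽 (IsLocalRing.ResidueField R)]
    (K : Type*) [Field K] [Algebra R K] [IsFractionRing R K]
    (Ks : Type*) [Field Ks] [Algebra K Ks] [IsSepClosure K Ks]
    [Algebra R Ks] [IsScalarTower R K Ks] [Algebra 𝔽 Ks] [IsScalarTower 𝔽 R Ks]
    {ζ : R} (hζm : ζ ∈ IsLocalRing.maximalIdeal R) (hζ : ζ ≠ 0)
    (M : LocalShtuka 𝔽 ζ) (r : ℕ) (hr : 1 ≤ r) (hM : M.rank = r)
    (d : ℤ) (hd : M.HasDimension d) (hpd : (p : ℤ) ∣ d) :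
    Nonempty (Module.Basis (Fin r) 𝔽⟦X⟧
      (M.tateModule (LocalShtuka.algebraMap_sep_ne_zero K Ks hζ))) ∧
    ∀ b : Module.Basis (Fin r) 𝔽⟦X⟧
        (M.tateModule (LocalShtuka.algebraMap_sep_ne_zero K Ks hζ)),
      ¬ IsOpen[zAdicTopologyGL 𝔽 r]
        (Set.range (M.galoisRepGL (K := K) (LocalShtuka.algebraMap_sep_ne_zero K Ks hζ) b)) := by
  subst hM
  have hζ' := LocalShtuka.algebraMap_sep_ne_zero K Ks hζ
  have : IsSepClosed Ks := IsSepClosure.sep_closed K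
  obtain ⟨b₀, T, hT, c, hdet⟩ := hd
  obtain ⟨k, rfl⟩ := hpd
  -- With `d = pk`, `w` is the image of `(z - ζ)^k` in `K^sep⟦z⟧`, so that `det τ` becomes `wᵖ c`.
  obtain ⟨w, hw⟩ := (zSubZeta ζ ^ k).isUnit.map (LocalShtuka.locToSep hζ')
  have hA := M.frob_sepBasis hζ' b₀ T hT
  have hdetA : (T.map (LocalShtuka.locToSep hζ')).det =
      (w : Ks⟦X⟧) ^ p * LocalShtuka.toSep R Ks c := by
    have h := (LocalShtuka.locToSep hζ').map_det T
    rw [hdet, map_mul, LocalShtuka.locToSep_toLoc, mul_comm (p : ℤ), zpow_mul, zpow_natCast,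
      Units.val_pow_eq_pow_val, map_pow, ← hw] at h
    exact h.symm
  have hunit : IsUnit (T.map (LocalShtuka.locToSep hζ')).det := by
    rw [hdetA]
    exact (w.isUnit.pow p).mul (c.isUnit.map (LocalShtuka.toSep R Ks))
  refine ⟨?_, M.not_isOpen_range_galoisRepGL hζ' hr b₀ _ hA w c hdetA⟩
  obtain ⟨B, hB⟩ := exists_basis_fixed (M.frob hζ') _ _ hA hunit
  exact ⟨M.tateBasis hζ' B hB⟩
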